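/- Let $\rho$ be a probability distribution on $X\times\mathbb R$ with $|y|\le L$ almost surely ($L>0$), let $\rho_X$ be its marginal on $X$, $\|\cdot\|_\rho$ the norm of $L^2(\rho_X)$ and $f_\rho(x)=\int y\,d\rho(y|x)$ the regression function. For every $N\ge 1$ let $\mathcal D_N=\{g_1,\dots,g_N\}$ (the $g_i$ may depend on $N$) be a dictionary of measurable functions on $X$ with $\|g_i\|_\rho=1$. For $h\in\mathrm{span}(\mathcal D_N)$ put $\|h\|_{\mathcal L_{1,N}}=\inf\{\sum_i|a_i| : h=\sum_i a_i g_i\}$. For $r>0$, $\mathcal L_1^r$ is the set of all $f$ for which there is a $\mathcal B$ such that for all $N\ge 1$ there is $h\in\mathrm{span}(\mathcal D_N)$ with $\|h\|_{\mathcal L_{1,N}}\le\mathcal B$ and $\|f-h\|_\rho\le\mathcal B N^{-r}$; $\|f\|_{\mathcal L_1^r}$ is the infimum of all such $\mathcal B$. Let $z=(x_i,y_i)_{i=1}^n$, $n\ge 2$, be drawn i.i.d. from $\rho$, and let $\langle u,v\rangle_n=\frac1n\sum_{i=1}^n u(x_i)v(x_i)$, with norm $\|\cdot\|_n$ (values $y_i$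 at $x_i$ are treated as a function $y$). Normalize the elements of $\mathcal D_N$ in the empirical norm, $\bar g_i=g_i/\|g_i\|_n$ (those with $\|g_i\|_n=0$ are dropped), and let $M(z)=\max_{i\ne j}|\langle\bar g_i,\bar g_j\rangle_n|$ be the coherence of the resulting dictionary ($M(z)=0$ if it has at most one element). The orthogonal super greedy algorithm with step-size $s\ge1$ starts from $f_0=0$; at iteration $k=1,2,\dots$ it selects $s$ distinct atoms $\bar g_i$ (all of them if there are fewer than $s$) such that no other atom $\bar g$ has a larger $|\langle y-f_{k-1},\bar g\rangle_n|$ than any selected one, and takes $f_k$ to be an orthogonal projection, with respect to $\langle\cdot,\cdot\rangle_n$, of $y$ on the span of all atoms selected so far. With $\Pi_L u=\min\{L,|u|\}\,\mathrm{sgn}(u)$ and $\kappa>0$, the estimator is $\hat f=\Pi_L f_{m^*}$, where $m^*$ minimizes over all integers $m>0$ the penalized empirical risk $$\|y-\Pi_L f_m\|_n^2+\kappa\,\frac{m s\log n}{n}.$$ Then for all $L>0$ and $a\ge 1$ there is $\kappa>0$, depending only on $L$ and $a$, such that the following holds. Let $a\ge\frac1{4r}$, $f_\rho\in\mathcal L_1^r$,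 $c_1n^a\le N\le c_2n^a$ with $c_1>0$, let $s\ge 1$ satisfy $s\le (2M(z))^{-1}+1$ for almost every sample $z$ (no restriction when $M(z)=0$), and let $s\le K (n/\log n)^{1/2}$. Then, however ties and non-unique projections are resolved, $$E\big(\|\hat f-f_\rho\|_\rho^2\big)\le C\,(n/\log n)^{-1/2},$$ where $C$ depends only on $\kappa$, $L$, $a$, an upper bound for $\|f_\rho\|_{\mathcal L_1^r}$, and the constants $c_1,c_2,K$. (For a fixed $s$ the choice $K=s$ covers every $n\ge2$.) -/

import Mathlib

open MeasureTheory

noncomputable section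

namespace OSGA

/-- The empirical inner product `(1/n) ∑ uᵢ vᵢ` of two vectors of values on the sample. -/
def empInner {n : ℕ} (u v : Fin n → ℝ) : ℝ :=
  (1 / (n : ℝ)) * ∑ i, u i * v i

/-- The empirical norm. -/
def empNorm {n : ℕ} (u : Fin n → ℝ) : ℝ :=
  Real.sqrt (empInner u u)

/-- The truncation operator `Π_L u = min {L, |u|} sgn u`. -/
def trunc (L u : ℝ) : ℝ :=
  min L |u| * Real.sign u

section Dictionary

variable {X : Type*} {n N : ℕ}

open Classical in
/-- The indices of the functions that can be normalized in the empirical norm, i.e. of those that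
do not vanish on the whole sample. The empirical dictionary consists of these functions. -/
def active (x : Fin n → X) (g : Fin N → X → ℝ) : Finset (Fin N) :=
  Finset.univ.filter fun i => empNorm (fun k => g i (x k)) ≠ 0

/-- The atom `gᵢ / ‖gᵢ‖ₙ`, of empirical norm one when `i` is active. -/
def atom (x : Fin n → X) (g : Fin N → X → ℝ) (i : Fin N) : X → ℝ :=
  (empNorm fun k => g i (x k))⁻¹ • g i

/-- The coherence of the empirically normalized dictionary in the empirical inner product
(zero if there are no two atoms). -/
def coherence (x : Fin n → X) (g : Fin N → X → ℝ) : ℝ :=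
  sSup {c : ℝ | ∃ i ∈ active x g, ∃ j ∈ active x g, i ≠ j ∧
    c = |empInner (fun k => atom x g i (x k)) (fun k => atom x g j (x k))|}

/-- `T` is an admissible choice of `s` distinct atoms (of all the atoms, if there are fewer than
`s`) for the residual `res`: no other atom has a larger correlation with the residual than any of
the chosen ones. -/
def IsGreedyBlock (x : Fin n → X) (g : Fin N → X → ℝ) (s : ℕ) (res : Fin n → ℝ)
    (T : Finset (Fin N)) : Prop :=
  T ⊆ active x g ∧ T.card = min s (active x g).card ∧
    ∀ i ∈ T, ∀ j ∈ active x g, j ∉ T →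
      |empInner res (fun k => atom x g j (x k))| ≤ |empInner res (fun k => atom x g i (x k))|

/-- `f 0, f 1, f 2, …` is a sequence of iterates of the orthogonal super greedy algorithm with
step-size `s` on the data `(x, y)`. Iteration `k + 1` selects the block `T k`, and `f (k + 1)` is an
orthogonal projection of `y` on the span of all the atoms selected so far, in the empirical inner
product. -/
structure IsRun (x : Fin n → X) (y : Fin n → ℝ) (g : Fin N → X → ℝ) (s : ℕ)
    (T : ℕ → Finset (Fin N)) (f : ℕ → X → ℝ) : Prop where
  init : f 0 = 0
  select : ∀ k, IsGreedyBlock x g s (fun i => y i - f k (x i)) (T k)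
  mem_span : ∀ k, f (k + 1) ∈ Submodule.span ℝ (atom x g '' {i | ∃ l ≤ k, i ∈ T l})
  orthogonal : ∀ k, ∀ l ≤ k, ∀ i ∈ T l,
    empInner (fun j => y j - f (k + 1) (x j)) (fun j => atom x g i (x j)) = 0

/-- The penalized empirical risk `‖y - Π_L f_m‖ₙ² + κ m s log n / n`. -/
def penalizedRisk (x : Fin n → X) (y : Fin n → ℝ) (L κ : ℝ) (s : ℕ) (f : ℕ → X → ℝ)
    (m : ℕ) : ℝ :=
  empNorm (fun i => y i - trunc L (f m (x i))) ^ 2 + κ * (m * s * Real.log n / n)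

/-- `fhat` is the complexity-regularized estimator on the data `z`: the truncation `Π_L f_{m*}` of
an iterate, where `m*` minimizes the penalized empirical risk over all `m > 0`. -/
def IsEstimator (z : Fin n → X × ℝ) (g : Fin N → X → ℝ) (L κ : ℝ) (s : ℕ) (fhat : X → ℝ) : Prop :=
  ∃ (T : ℕ → Finset (Fin N)) (f : ℕ → X → ℝ) (mstar : ℕ),
    IsRun (fun i => (z i).1) (fun i => (z i).2) g s T f ∧
    0 < mstar ∧
    (∀ m : ℕ, 0 < m →
      penalizedRisk (fun i => (z i).1) (fun i => (z i).2) L κ s f mstar ≤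
        penalizedRisk (fun i => (z i).1) (fun i => (z i).2) L κ s f m) ∧
    fhat = fun u => trunc L (f mstar u)

/-- The norm `inf {∑ |cᵢ| : h = ∑ cᵢ gᵢ}` on the span of the dictionary. -/
def l1Norm (g : Fin N → X → ℝ) (h : X → ℝ) : ℝ :=
  sInf {t : ℝ | ∃ c : Fin N → ℝ, h = ∑ i, c i • g i ∧ t = ∑ i, |c i|}

end Dictionary

section Smoothness

variable {X : Type*} [MeasurableSpace X]

/-- The constants `B` such that, for all `N ≥ 1`, some `h` in the span of the `N`-th dictionary has
`‖h‖_{L₁} ≤ B` and `‖f - h‖ ≤ B N^{-r}`. -/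
def l1rBounds (μ : Measure X) (g : (N : ℕ) → Fin N → X → ℝ) (r : ℝ) (f : X → ℝ) : Set ℝ :=
  {B : ℝ | ∀ N : ℕ, 1 ≤ N → ∃ h ∈ Submodule.span ℝ (Set.range (g N)),
    l1Norm (g N) h ≤ B ∧ eLpNorm (f - h) 2 μ ≤ ENNReal.ofReal (B * (N : ℝ) ^ (-r))}

/-- The class `L₁^r` of a family of dictionaries. -/
def MemL1r (μ : Measure X) (g : (N : ℕ) → Fin N → X → ℝ) (r : ℝ) (f : X → ℝ) : Prop :=
  (l1rBounds μ g r f).Nonempty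

/-- The norm of `L₁^r`. -/
def l1rNorm (μ : Measure X) (g : (N : ℕ) → Fin N → X → ℝ) (r : ℝ) (f : X → ℝ) : ℝ :=
  sInf (l1rBounds μ g r f)

/-- The regression function `f_ρ(x) = ∫ y dρ(y|x)`. -/
def regressionFun (ρ : Measure (X × ℝ)) [IsFiniteMeasure ρ] (x : X) : ℝ :=
  ∫ y, y ∂(ρ.condKernel x)

end Smoothness

end OSGA

end

/-! The proof is an oracle inequality with two halves: a deterministic rate for the algorithm on a
fixed sample, and a one-sided uniform deviation bound for truncated combinations of few dictionary
elements.

Greedy half. After `m + 1` iterations the squared empirical residual exceeds that of any `∑ aᵢ φᵢ`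
over unit atoms by at most a constant times `A ^ 2 / (s m)`, where `A = ∑ |aᵢ|`
(`IsIncoherent.greedy_norm_sq_le`). The gain `1 / s` is not automatic: a coefficient of size `A` on
one atom is not served faster by large blocks. Low coherence repairs this. If every correlation in
the first block is well above `A / s`, the first projection already beats the comparison function.
Otherwise an unselected atom with a coefficient well above `A / s` has a smaller correlation with
`y`, and dropping it improves the comparison function. The coefficients that survive off the first
block are `O(A / s)`, and the usual recursion `e_{k+1} ≤ e_k - e_k ^ 2 / D` applies with `D` of
order `A ^ 2 / s`.

Statistical half. For bounded functions with `E l ^ 2 ≤ b E l`, the difference of `E l` and twice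
the empirical mean is controlled by an offset process: the term `-l ^ 2 / b` on a ghost sample
absorbs the fluctuations of random exchanges (`exp_add_exp_offset_le`), so no chaining or
concentration inequality is needed (`exists_integral_sub_le`). Excess losses of truncated predictors
satisfy the moment condition because the regression function is the conditional mean. On a double
sample, the predictors with support `S` fall into at most `n ^ (4 |S|)` cells by Sauer–Shelah. The
penalty `|S| log n / n` pays for these cells and for the choice of `S` among the subsets of a
dictionary of size `O(n ^ a)`; this fixes `κ`.

Since the estimator minimizes the penalized risk, it can be compared with any number of iterations.
Taking `s m` of order `(n / log n) ^ (1/2)` balances `A ^ 2 / (s m)` against `κ s m log n / n`, and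
`4 r a ≥ 1` makes the squared approximation error `O(n ^ (-1/2))`. -/

namespace OSGA

/-! ### Incoherent families: one projection step, comparison functions, the recursion -/

section Greedy

variable {E ι : Type*} [NormedAddCommGroup E] [InnerProductSpace ℝ E]

open scoped RealInnerProductSpace

/-- A finite family of unit vectors `φ i`, `i ∈ I`, whose coherence is at most `M`, where `M` is
small compared with the step-size `s`. -/
structure IsIncoherent (φ : ι → E) (I : Finset ι) (s : ℕ) (M : ℝ) : Prop where
  unit : ∀ i ∈ I, ⟪φ i, φ i⟫ = 1
  nonneg : 0 ≤ M
  le : ∀ i ∈ I, ∀ j ∈ I, i ≠ j → |⟪φ i, φ j⟫| ≤ M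
  one_le : 1 ≤ s
  two_mul_le : 2 * M * ((s : ℝ) - 1) ≤ 1
  mul_le : M * s ≤ 1

theorem abs_sum_mul_le {I : Finset ι} {a b : ι → ℝ} {θ : ℝ} (hb : ∀ i ∈ I, |b i| ≤ θ) :
    |∑ i ∈ I, a i * b i| ≤ θ * ∑ i ∈ I, |a i| := by
  refine (Finset.abs_sum_le_sum_abs _ _).trans ?_
  rw [Finset.mul_sum]
  refine Finset.sum_le_sum fun i hi => ?_
  rw [abs_mul, mul_comm]
  exact mul_le_mul_of_nonneg_right (hb i hi) (abs_nonneg _)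

variable {φ : ι → E} {I : Finset ι} {s : ℕ} {M : ℝ}

/-- A diagonal entry contributes `1` and the others at most `(s - 1) M ≤ 1 / 2`; without a diagonal
entry the sum is at most `s M ≤ 1`. -/
theorem IsIncoherent.row_sum_le (H : IsIncoherent φ I s M) {T : Finset ι} (hT : T ⊆ I)
    (hTs : T.card ≤ s) {i : ι} (hi : i ∈ I) : ∑ j ∈ T, |⟪φ i, φ j⟫| ≤ 3 / 2 := by
  classical
  have hTs' : (T.card : ℝ) ≤ s := by exact_mod_cast hTs
  have h0 := H.nonneg
  by_cases hiT : i ∈ T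
  · rw [← Finset.add_sum_erase _ _ hiT, H.unit i hi]
    have h1 : ∑ j ∈ T.erase i, |⟪φ i, φ j⟫| ≤ (T.erase i).card • M :=
      Finset.sum_le_card_nsmul _ _ _ fun j hj =>
        H.le i hi j (hT (Finset.mem_of_mem_erase hj)) (Finset.ne_of_mem_erase hj).symm
    have h2 : ((T.erase i).card : ℝ) = T.card - 1 := by
      have := Finset.card_erase_add_one hiT
      rw [← this]; push_cast; ring
    rw [nsmul_eq_mul, h2] at h1
    have h3 := H.two_mul_le
    rw [abs_one]
    nlinarith
  · have h1 : ∑ j ∈ T, |⟪φ i, φ j⟫| ≤ T.card • M :=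
      Finset.sum_le_card_nsmul _ _ _ fun j hj =>
        H.le i hi j (hT hj) (fun h => hiT (h ▸ hj))
    rw [nsmul_eq_mul] at h1
    have h3 := H.mul_le
    nlinarith

theorem inner_sum_smul (v : E) (T : Finset ι) (c : ι → ℝ) (φ : ι → E) :
    ⟪v, ∑ j ∈ T, c j • φ j⟫ = ∑ j ∈ T, c j * ⟪v, φ j⟫ := by
  simp [inner_sum, inner_smul_right]

/-- Gershgorin's argument: expand the square and bound each row of the Gram matrix by `3 / 2`. -/
theorem IsIncoherent.norm_sq_le (H : IsIncoherent φ I s M) {T : Finset ι} (hT : T ⊆ I)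
    (hTs : T.card ≤ s) {σ : ι → ℝ} (hσ : ∀ i, |σ i| ≤ 1) :
    ‖∑ j ∈ T, σ j • φ j‖ ^ 2 ≤ 3 / 2 * s := by
  have hTs' : (T.card : ℝ) ≤ s := by exact_mod_cast hTs
  have h1 : ∀ i ∈ T, |⟪φ i, ∑ j ∈ T, σ j • φ j⟫| ≤ 3 / 2 := by
    intro i hi
    rw [inner_sum_smul]
    refine (Finset.abs_sum_le_sum_abs _ _).trans (le_trans ?_ (H.row_sum_le hT hTs (hT hi)))
    refine Finset.sum_le_sum fun j _ => ?_
    rw [abs_mul]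
    exact mul_le_of_le_one_left (abs_nonneg _) (hσ j)
  rw [← real_inner_self_eq_norm_sq]
  rw [inner_sum_smul]
  have h2 := abs_sum_mul_le (I := T) (a := σ) (b := fun i => ⟪φ i, ∑ j ∈ T, σ j • φ j⟫) h1
  have h3 : ∑ i ∈ T, |σ i| ≤ T.card • (1 : ℝ) := Finset.sum_le_card_nsmul _ _ _ fun i _ => hσ i
  rw [nsmul_eq_mul, mul_one] at h3
  have h4 := le_abs_self (∑ i ∈ T, σ i * ⟪φ i, ∑ j ∈ T, σ j • φ j⟫)
  have h5 : ∑ i ∈ T, σ i * ⟪∑ j ∈ T, σ j • φ j, φ i⟫ = ∑ i ∈ T, σ i * ⟪φ i, ∑ j ∈ T, σ j • φ j⟫ :=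
    Finset.sum_congr rfl fun i _ => by rw [real_inner_comm]
  rw [h5]
  linarith

theorem abs_sign_le_one (x : ℝ) : |Real.sign x| ≤ 1 := by
  rcases Real.sign_apply_eq x with h | h | h <;> simp [h]

theorem sign_mul_self_eq_abs (x : ℝ) : Real.sign x * x = |x| := by
  rcases lt_trichotomy x 0 with h | h | h
  · rw [Real.sign_of_neg h, abs_of_neg h]; ring
  · simp [h]
  · rw [Real.sign_of_pos h, abs_of_pos h]; ring

theorem inner_sum_sign (v : E) (T : Finset ι) (φ : ι → E) :
    ⟪v, ∑ j ∈ T, Real.sign ⟪v, φ j⟫ • φ j⟫ = ∑ j ∈ T, |⟪v, φ j⟫| := by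
  rw [inner_sum_smul]
  exact Finset.sum_congr rfl fun j _ => sign_mul_self_eq_abs _

/-- Projecting out a block of at most `s` incoherent vectors decreases the norm in proportion to the
sum of the correlations. -/
theorem IsIncoherent.norm_sq_le_sub (H : IsIncoherent φ I s M) {T : Finset ι} (hT : T ⊆ I)
    (hTs : T.card ≤ s) {r r' : E} (hr : ∀ c : ι → ℝ, ‖r'‖ ≤ ‖r - ∑ j ∈ T, c j • φ j‖) :
    ‖r'‖ ^ 2 ≤ ‖r‖ ^ 2 - 2 / 3 * (∑ j ∈ T, |⟪r, φ j⟫|) ^ 2 / s := by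
  have hs : (0 : ℝ) < s := by exact_mod_cast H.one_le
  set Q := ∑ j ∈ T, |⟪r, φ j⟫| with hQ
  set w := ∑ j ∈ T, Real.sign ⟪r, φ j⟫ • φ j with hw
  -- The minimizer of `-2 t Q + t ^ 2 * (3 / 2 * s)`, the bound for the change along the sign
  -- combination `w`.
  set t : ℝ := 2 / 3 * Q / s with ht
  have h1 : ‖r'‖ ≤ ‖r - t • w‖ := by
    have := hr fun j => t * Real.sign ⟪r, φ j⟫
    simpa only [mul_smul, ← Finset.smul_sum, ← hw] using this
  have h2 : ‖w‖ ^ 2 ≤ 3 / 2 * s := H.norm_sq_le hT hTs fun _ => abs_sign_le_one _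
  have h3 : ⟪r, w⟫ = Q := inner_sum_sign r T φ
  have h4 : ‖r - t • w‖ ^ 2 = ‖r‖ ^ 2 - 2 * t * Q + t ^ 2 * ‖w‖ ^ 2 := by
    rw [norm_sub_sq_real, inner_smul_right, h3, norm_smul, mul_pow, Real.norm_eq_abs, sq_abs]; ring
  have h5 : ‖r'‖ ^ 2 ≤ ‖r - t • w‖ ^ 2 := pow_le_pow_left₀ (norm_nonneg _) h1 2
  have h6 : t ^ 2 * ‖w‖ ^ 2 ≤ t ^ 2 * (3 / 2 * s) := mul_le_mul_of_nonneg_left h2 (sq_nonneg t)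
  have h7 : - 2 * t * Q + t ^ 2 * (3 / 2 * s) = - (2 / 3 * Q ^ 2 / s) := by
    rw [ht]; field_simp; ring
  linarith

theorem IsIncoherent.abs_inner_sum_le (H : IsIncoherent φ I s M) {S T : Finset ι} (hS : S ⊆ I)
    (hT : T ⊆ I) (hST : Disjoint S T) (a : ι → ℝ) :
    |⟪∑ j ∈ S, a j • φ j, ∑ j ∈ T, a j • φ j⟫| ≤ M * (∑ j ∈ S, |a j|) * ∑ j ∈ T, |a j| := by
  rw [inner_sum_smul]
  refine abs_sum_mul_le fun i hi => ?_
  rw [real_inner_comm, inner_sum_smul]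
  refine abs_sum_mul_le fun j hj => ?_
  exact H.le i (hT hi) j (hS hj) fun h => Finset.disjoint_left.1 hST hj (h ▸ hi)

/-- If all correlations in the first block are large, the first projection already beats every
combination of small `ℓ¹` norm. -/
theorem IsIncoherent.norm_sq_le_of_lt (H : IsIncoherent φ I s M) {T : Finset ι} (hT : T ⊆ I)
    (hTs : T.card = s) {y r' : E} (hr : ∀ c : ι → ℝ, ‖r'‖ ≤ ‖y - ∑ j ∈ T, c j • φ j‖)
    {a : ι → ℝ} {A θ : ℝ} (hA : ∑ i ∈ I, |a i| ≤ A) (hθ : 7 * A < s * θ)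
    (hlow : ∀ j ∈ T, θ ≤ |⟪y, φ j⟫|) (hup : ∀ i ∈ I, i ∉ T → |⟪y, φ i⟫| ≤ θ) :
    ‖r'‖ ^ 2 ≤ ‖y - ∑ i ∈ I, a i • φ i‖ ^ 2 := by
  classical
  have hs : (0 : ℝ) < s := by exact_mod_cast H.one_le
  have hA0 : 0 ≤ A := (Finset.sum_nonneg fun _ _ => abs_nonneg _).trans hA
  have hθ0 : 0 < θ := by
    by_contra h
    have : (s : ℝ) * θ ≤ 0 := mul_nonpos_of_nonneg_of_nonpos hs.le (not_lt.1 h)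
    linarith
  set u := ∑ j ∈ T, a j • φ j with hu
  set v := ∑ j ∈ I \ T, a j • φ j with hv
  set w := ∑ j ∈ T, Real.sign ⟪y, φ j⟫ • φ j with hw
  have hsum : ∑ j ∈ I \ T, |a j| + ∑ j ∈ T, |a j| = ∑ j ∈ I, |a j| := Finset.sum_sdiff hT
  have hT0 : 0 ≤ ∑ j ∈ T, |a j| := Finset.sum_nonneg fun _ _ => abs_nonneg _
  have hI0 : 0 ≤ ∑ j ∈ I \ T, |a j| := Finset.sum_nonneg fun _ _ => abs_nonneg _
  have huv : ∑ i ∈ I, a i • φ i = v + u := (Finset.sum_sdiff hT).symm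
  -- The competitor keeps the comparison coefficients on `T` and adds `θ / 2` in the direction of
  -- the signs. The signs gain at least `5 / 8 s θ ^ 2 - 3 / 2 A θ`, while omitting `v` costs at
  -- most `2 A θ + 2 M A ^ 2`; the factor `7` in `hθ` makes the gain larger.
  have h1 : ‖r'‖ ^ 2 ≤ ‖(y - u) - (θ / 2) • w‖ ^ 2 := by
    refine pow_le_pow_left₀ (norm_nonneg _) ?_ 2
    have := hr fun j => a j + θ / 2 * Real.sign ⟪y, φ j⟫
    simpa only [add_smul, mul_smul, Finset.sum_add_distrib, ← Finset.smul_sum, ← hw, ← hu,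
      ← sub_sub] using this
  have h2 : ‖w‖ ^ 2 ≤ 3 / 2 * s := H.norm_sq_le hT hTs.le fun _ => abs_sign_le_one _
  have h3 : s * θ ≤ ⟪y, w⟫ := by
    rw [hw, inner_sum_sign]
    have := Finset.card_nsmul_le_sum T (fun j => |⟪y, φ j⟫|) θ hlow
    rwa [hTs, nsmul_eq_mul] at this
  have h4 : ⟪u, w⟫ ≤ 3 / 2 * A := by
    rw [real_inner_comm, hu, inner_sum_smul]
    have : ∀ j ∈ T, |⟪w, φ j⟫| ≤ 3 / 2 := by
      intro j hj
      rw [real_inner_comm, hw, inner_sum_smul]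
      refine (Finset.abs_sum_le_sum_abs _ _).trans
        (le_trans ?_ (H.row_sum_le hT hTs.le (hT hj)))
      refine Finset.sum_le_sum fun i _ => ?_
      rw [abs_mul]
      exact mul_le_of_le_one_left (abs_nonneg _) (abs_sign_le_one _)
    have := (le_abs_self _).trans (abs_sum_mul_le (a := a) this)
    linarith
  have h5 : ⟪y, v⟫ ≤ θ * A := by
    rw [hv, inner_sum_smul]
    refine ((le_abs_self _).trans (abs_sum_mul_le (θ := θ) fun i hi => ?_)).trans ?_
    · rw [Finset.mem_sdiff] at hi
      exact hup i hi.1 hi.2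
    · exact mul_le_mul_of_nonneg_left (by linarith) hθ0.le
  have h6 : - (M * A * A) ≤ ⟪u, v⟫ := by
    have := H.abs_inner_sum_le hT (Finset.sdiff_subset (s := I) (t := T)) Finset.disjoint_sdiff a
    have h7 : M * (∑ j ∈ T, |a j|) * ∑ j ∈ I \ T, |a j| ≤ M * A * A := by
      have := H.nonneg
      gcongr <;> linarith
    exact (abs_le.1 (this.trans h7)).1
  have h8 : ‖(y - u) - (θ / 2) • w‖ ^ 2
      = ‖y - u‖ ^ 2 - θ * (⟪y, w⟫ - ⟪u, w⟫) + θ ^ 2 / 4 * ‖w‖ ^ 2 := by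
    rw [norm_sub_sq_real (y - u), inner_smul_right, norm_smul, mul_pow, Real.norm_eq_abs, sq_abs,
      inner_sub_left]; ring
  have h9 : ‖y - (v + u)‖ ^ 2 = ‖y - u‖ ^ 2 - 2 * (⟪y, v⟫ - ⟪u, v⟫) + ‖v‖ ^ 2 := by
    rw [show y - (v + u) = (y - u) - v by abel, norm_sub_sq_real (y - u), inner_sub_left]
  rw [huv, h9]
  refine h1.trans ?_
  rw [h8]
  have h10 : θ ^ 2 / 4 * ‖w‖ ^ 2 ≤ θ ^ 2 / 4 * (3 / 2 * s) :=
    mul_le_mul_of_nonneg_left h2 (by positivity)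
  have h11 : θ * (s * θ - 3 / 2 * A) ≤ θ * (⟪y, w⟫ - ⟪u, w⟫) :=
    mul_le_mul_of_nonneg_left (by linarith) hθ0.le
  have h12 : 7 * (M * A * A) ≤ A * θ := by
    have h14 : M * (7 * A) ≤ M * (s * θ) := mul_le_mul_of_nonneg_left hθ.le H.nonneg
    have h15 : M * s * θ ≤ 1 * θ := mul_le_mul_of_nonneg_right H.mul_le hθ0.le
    nlinarith
  have h16 : θ * (7 * A) ≤ θ * (s * θ) := mul_le_mul_of_nonneg_left hθ.le hθ0.le
  have h17 : 0 ≤ ‖v‖ ^ 2 := by positivity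
  nlinarith

/-- Removing from a combination coefficients that are large although the correlation of the
corresponding vector with `y` is small brings it closer to `y`. -/
theorem IsIncoherent.norm_sq_remove_le [DecidableEq ι] (H : IsIncoherent φ I s M) {U : Finset ι} (hU : U ⊆ I)
    {y : E} {a : ι → ℝ} {A θ : ℝ} (hA : ∑ i ∈ I, |a i| ≤ A)
    (hup : ∀ i ∈ U, |⟪y, φ i⟫| ≤ θ) (hbig : ∀ i ∈ U, 2 * θ + 3 * (M * A) ≤ |a i|) :
    ‖y - ∑ i ∈ I, (if i ∈ U then 0 else a i) • φ i‖ ^ 2 ≤ ‖y - ∑ i ∈ I, a i • φ i‖ ^ 2 := by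
  have hA0 : 0 ≤ A := (Finset.sum_nonneg fun _ _ => abs_nonneg _).trans hA
  set v := ∑ j ∈ U, a j • φ j with hv
  set h := ∑ i ∈ I, a i • φ i with hh
  have hsplit : ∑ i ∈ I, (if i ∈ U then 0 else a i) • φ i = h - v := by
    rw [eq_sub_iff_add_eq, hv, hh]
    have : ∑ j ∈ U, a j • φ j = ∑ j ∈ I, (if j ∈ U then a j else 0) • φ j := by
      simp only [ite_smul, zero_smul]
      rw [Finset.sum_ite_mem, Finset.inter_eq_right.2 hU]
    rw [this, ← Finset.sum_add_distrib]
    refine Finset.sum_congr rfl fun i _ => ?_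
    split_ifs <;> simp
  have key : ∀ S ⊆ I, ∀ i ∈ I, |∑ j ∈ S, a j * (if j = i then 0 else ⟪φ i, φ j⟫)| ≤ M * A := by
    intro S hS i hi
    refine (abs_sum_mul_le (θ := M) fun j hj => ?_).trans ?_
    · split_ifs with hji
      · simpa using H.nonneg
      · exact H.le i hi j (hS hj) (Ne.symm hji)
    · exact mul_le_mul_of_nonneg_left
        ((Finset.sum_le_sum_of_subset_of_nonneg hS fun _ _ _ => abs_nonneg _).trans hA) H.nonneg
  have key2 : ∀ S ⊆ I, ∀ i ∈ S, ⟪φ i, ∑ j ∈ S, a j • φ j⟫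
      = a i + ∑ j ∈ S, a j * (if j = i then 0 else ⟪φ i, φ j⟫) := by
    intro S hS i hi
    rw [inner_sum_smul, ← Finset.add_sum_erase _ _ hi, H.unit i (hS hi),
      ← Finset.add_sum_erase (a := i) S (fun j => a j * (if j = i then 0 else ⟪φ i, φ j⟫)) hi]
    simp only [if_true, mul_one, mul_zero, zero_add]
    congr 1
    refine Finset.sum_congr rfl fun j hj => ?_
    rw [if_neg (Finset.ne_of_mem_erase hj)]
  have h1 : ‖y - (h - v)‖ ^ 2 = ‖y - h‖ ^ 2 + (2 * ⟪y - h, v⟫ + ⟪v, v⟫) := by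
    rw [show y - (h - v) = (y - h) + v by abel, norm_add_sq_real, real_inner_self_eq_norm_sq]; ring
  have h2 : 2 * ⟪y - h, v⟫ + ⟪v, v⟫
      = ∑ i ∈ U, a i * (2 * ⟪y, φ i⟫ - 2 * ⟪φ i, h⟫ + ⟪φ i, v⟫) := by
    conv_lhs => rw [hv]
    rw [inner_sum_smul, inner_sum_smul, Finset.mul_sum, ← Finset.sum_add_distrib]
    refine Finset.sum_congr rfl fun i _ => ?_
    rw [← hv, inner_sub_left, real_inner_comm (φ i) h, real_inner_comm (φ i) v]
    ring
  rw [hsplit, h1, h2]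
  -- Up to the cross terms `p` and `q`, both inner products equal `a i`, so the bracket is `-a i`
  -- plus an error of size at most `2 θ + 3 M A ≤ |a i|`: every summand is nonpositive.
  have h3 : ∑ i ∈ U, a i * (2 * ⟪y, φ i⟫ - 2 * ⟪φ i, h⟫ + ⟪φ i, v⟫) ≤ 0 := by
    refine Finset.sum_nonpos fun i hi => ?_
    have e1 := key2 I subset_rfl i (hU hi)
    have e2 := key2 U hU i hi
    have b1 := key I subset_rfl i (hU hi)
    have b2 := key U hU i (hU hi)
    have b3 := hup i hi
    have b4 := hbig i hi
    rw [e1, e2]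
    set p := ∑ j ∈ I, a j * (if j = i then 0 else ⟪φ i, φ j⟫)
    set q := ∑ j ∈ U, a j * (if j = i then 0 else ⟪φ i, φ j⟫)
    rw [abs_le] at b1 b2 b3
    rcases abs_cases (a i) with ⟨ha, ha'⟩ | ⟨ha, ha'⟩
    · exact mul_nonpos_of_nonneg_of_nonpos ha' (by linarith)
    · exact mul_nonpos_of_nonpos_of_nonneg ha'.le (by linarith)
  linarith

/-- The recursion is required only from `e 1` on and only while `e` is nonnegative: the first block
is treated separately, and the residual may become smaller than that of the comparison function. No
bound on `e 1` is needed, as `x - x ^ 2 / D ≤ D / 4`. -/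
theorem le_div_of_sub_sq_le {e : ℕ → ℝ} {D : ℝ} (hD : 0 < D) (hanti : ∀ k, e (k + 1) ≤ e k)
    (hstep : ∀ k, 1 ≤ k → 0 ≤ e k → e (k + 1) ≤ e k - e k ^ 2 / D) {m : ℕ} (hm : 1 ≤ m) :
    e (m + 1) ≤ D / m := by
  have aux : ∀ x : ℝ, x - x ^ 2 / D ≤ D / (1 : ℕ) := by
    intro x
    have : x - x ^ 2 / D = D / 4 - (x - D / 2) ^ 2 / D := by field_simp; ring
    rw [this]
    have : 0 ≤ (x - D / 2) ^ 2 / D := by positivity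
    push_cast; linarith
  induction m, hm using Nat.le_induction with
  | base =>
    rcases le_total 0 (e 1) with h | h
    · exact (hstep 1 le_rfl h).trans (aux _)
    · refine (hanti 1).trans (h.trans (by positivity))
  | succ m hm ih =>
    have hm0 : (1 : ℝ) ≤ m := by exact_mod_cast hm
    rcases le_total 0 (e (m + 1)) with h | h
    · refine (hstep (m + 1) (by omega) h).trans ?_
      rw [le_div_iff₀ (by linarith)] at ih
      set x := e (m + 1)
      have : x - x ^ 2 / D = (x * D - x ^ 2) / D := by field_simp
      push_cast
      rw [this, div_le_div_iff₀ hD (by positivity)]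
      obtain ⟨v, hv⟩ : ∃ v, D = m * x + v := ⟨D - m * x, by ring⟩
      have hv0 : 0 ≤ v := by nlinarith
      rw [hv]
      nlinarith [mul_nonneg (mul_nonneg h hv0) (sub_nonneg.2 hm0), sq_nonneg x, sq_nonneg v]
    · refine (hanti _).trans (h.trans (by positivity))

end Greedy

/-! ### The convergence rate of the super greedy algorithm -/

section GreedyRate

variable {E ι : Type*} [NormedAddCommGroup E] [InnerProductSpace ℝ E]
variable {φ : ι → E} {I : Finset ι} {s : ℕ} {M : ℝ}

open scoped RealInnerProductSpace

theorem norm_le_of_forall_inner_eq_zero {S : Set E} {y p v : E} (hp : p ∈ Submodule.span ℝ S)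
    (ho : ∀ w ∈ S, ⟪y - p, w⟫ = 0) (hv : v ∈ Submodule.span ℝ S) : ‖y - p‖ ≤ ‖y - v‖ := by
  have h1 : ∀ w ∈ Submodule.span ℝ S, ⟪y - p, w⟫ = 0 := by
    intro w hw
    induction hw using Submodule.span_induction with
    | mem w hw => exact ho w hw
    | zero => simp
    | add u w _ _ hu hw => rw [inner_add_right, hu, hw, add_zero]
    | smul c w _ hw => rw [inner_smul_right, hw, mul_zero]
  have h2 := h1 (p - v) (Submodule.sub_mem _ hp hv)
  have h3 : ‖y - v‖ ^ 2 = ‖y - p‖ ^ 2 + ‖p - v‖ ^ 2 := by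
    rw [show y - v = (y - p) + (p - v) by abel, norm_add_sq_real, h2]; ring
  refine le_of_sq_le_sq ?_ (norm_nonneg _)
  nlinarith [sq_nonneg ‖p - v‖]

/-- The convergence rate of the orthogonal super greedy algorithm relative to an arbitrary
combination of the atoms. -/
theorem IsIncoherent.greedy_norm_sq_le (H : IsIncoherent φ I s M) {T : ℕ → Finset ι} {f : ℕ → E}
    {y : E} (hf0 : f 0 = 0) (hT : ∀ k, T k ⊆ I) (hTc : ∀ k, (T k).card = min s I.card)
    (hgreedy : ∀ k, ∀ i ∈ T k, ∀ j ∈ I, j ∉ T k → |⟪y - f k, φ j⟫| ≤ |⟪y - f k, φ i⟫|)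
    (hspan : ∀ k, f (k + 1) ∈ Submodule.span ℝ (φ '' {i | ∃ l ≤ k, i ∈ T l}))
    (horth : ∀ k, ∀ l ≤ k, ∀ i ∈ T l, ⟪y - f (k + 1), φ i⟫ = 0) (a : ι → ℝ) {m : ℕ}
    (hm : 1 ≤ m) :
    ‖y - f (m + 1)‖ ^ 2
      ≤ ‖y - ∑ i ∈ I, a i • φ i‖ ^ 2 + 1944 * (∑ i ∈ I, |a i|) ^ 2 / s / m := by
  classical
  have hs : (0 : ℝ) < s := by exact_mod_cast H.one_le
  set A := ∑ i ∈ I, |a i| with hA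
  have hA0 : 0 ≤ A := Finset.sum_nonneg fun _ _ => abs_nonneg _
  let V : ℕ → Submodule ℝ E := fun k => Submodule.span ℝ (φ '' {i | ∃ l ≤ k, i ∈ T l})
  have hbest : ∀ k, ∀ v ∈ V k, ‖y - f (k + 1)‖ ≤ ‖y - v‖ := fun k v hv =>
    norm_le_of_forall_inner_eq_zero (hspan k) (by
      rintro _ ⟨i, ⟨l, hl, hi⟩, rfl⟩; exact horth k l hl i hi) hv
  have hmono : ∀ k, V k ≤ V (k + 1) := fun k =>
    Submodule.span_mono (Set.image_mono fun i ⟨l, hl, hi⟩ => ⟨l, by omega, hi⟩)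
  have hfV : ∀ k, f k ∈ V k := by
    rintro (_ | k)
    · rw [hf0]; exact Submodule.zero_mem _
    · exact hmono k (hspan k)
  have hφV : ∀ k, ∀ i ∈ T k, φ i ∈ V k := fun k i hi =>
    Submodule.subset_span ⟨i, ⟨k, le_rfl, hi⟩, rfl⟩
  have hcV : ∀ k, ∀ c : ι → ℝ, ∑ j ∈ T k, c j • φ j ∈ V k := fun k c =>
    Submodule.sum_mem _ fun i hi => Submodule.smul_mem _ _ (hφV k i hi)
  have hanti : Antitone fun k => ‖y - f k‖ ^ 2 :=
    antitone_nat_of_succ_le fun k => pow_le_pow_left₀ (norm_nonneg _) (hbest k _ (hfV k)) 2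
  have hblock : ∀ k, ∀ c : ι → ℝ, ‖y - f (k + 1)‖ ≤ ‖(y - f k) - ∑ j ∈ T k, c j • φ j‖ :=
    fun k c => by
      rw [sub_sub]; exact hbest k _ (Submodule.add_mem _ (hfV k) (hcV k c))
  have hpos : 0 ≤ 1944 * A ^ 2 / s / m := by positivity
  have hfirst : ‖y - f 1‖ ^ 2 ≤ ‖y - ∑ i ∈ I, a i • φ i‖ ^ 2 →
      ‖y - f (m + 1)‖ ^ 2 ≤ ‖y - ∑ i ∈ I, a i • φ i‖ ^ 2 + 1944 * A ^ 2 / s / m := by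
    intro h
    have : ‖y - f (m + 1)‖ ^ 2 ≤ ‖y - f 1‖ ^ 2 := hanti (by omega)
    linarith
  -- With at most `s` atoms the first block contains all of them, and one projection is optimal.
  rcases le_total I.card s with hIs | hIs
  · have hTI : T 0 = I := Finset.eq_of_subset_of_card_le (hT 0) (by rw [hTc, min_eq_right hIs])
    refine hfirst (pow_le_pow_left₀ (norm_nonneg _) ?_ 2)
    have := hblock 0 a
    rwa [hf0, sub_zero, hTI] at this
  have hTs : ∀ k, (T k).card = s := fun k => by rw [hTc, min_eq_left hIs]
  obtain ⟨i₀, hi₀, hmin⟩ := Finset.exists_min_image (T 0) (fun i => |⟪y, φ i⟫|)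
    (Finset.card_pos.1 (by rw [hTs]; exact H.one_le))
  set θ := |⟪y, φ i₀⟫| with hθ
  have hg0 : ∀ i ∈ I, i ∉ T 0 → |⟪y, φ i⟫| ≤ θ := fun i hi hi0 => by
    have := hgreedy 0 i₀ hi₀ i hi hi0
    rwa [hf0, sub_zero] at this
  rcases lt_or_ge (7 * A) (s * θ) with hlt | hge
  · refine hfirst (H.norm_sq_le_of_lt (hT 0) (hTs 0) (fun c => ?_) le_rfl hlt hmin hg0)
    have := hblock 0 c
    rwa [hf0, sub_zero] at this
  rcases hA0.eq_or_lt with hA00 | hApos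
  · refine hfirst (pow_le_pow_left₀ (norm_nonneg _) ?_ 2)
    have : ∑ i ∈ I, a i • φ i = 0 := Finset.sum_eq_zero fun i hi => by
      have := (Finset.sum_eq_zero_iff_of_nonneg fun i _ => abs_nonneg (a i)).1 hA00.symm i hi
      rw [abs_eq_zero.1 this, zero_smul]
    rw [this]
    exact hbest 0 0 (Submodule.zero_mem _)
  -- Here `θ ≤ 7 A / s` and `M A ≤ A / s`, so `17 = 2 * 7 + 3` meets the removal threshold `2 θ + 3
  -- M A`.
  set τ := 17 * A / s with hτ
  set U := I.filter fun i => i ∉ T 0 ∧ τ < |a i| with hU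
  set h' := ∑ i ∈ I, (if i ∈ U then 0 else a i) • φ i with hh'
  have hrem : ‖y - h'‖ ^ 2 ≤ ‖y - ∑ i ∈ I, a i • φ i‖ ^ 2 := by
    refine H.norm_sq_remove_le (Finset.filter_subset _ _) le_rfl (θ := θ) ?_ ?_
    · intro i hi
      rw [Finset.mem_filter] at hi
      exact hg0 i hi.1 hi.2.1
    · intro i hi
      rw [Finset.mem_filter] at hi
      refine le_trans ?_ hi.2.2.le
      have h1 : θ ≤ 7 * A / s := by rw [le_div_iff₀ hs]; linarith
      have h2 : M * A ≤ A / s := by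
        rw [le_div_iff₀ hs]
        nlinarith [mul_le_mul_of_nonneg_right H.mul_le hA0]
      have h3 : τ = 2 * (7 * A / s) + 3 * (A / s) := by rw [hτ]; ring
      linarith
  set Q : ℕ → ℝ := fun k => ∑ j ∈ T k, |⟪y - f k, φ j⟫| with hQ
  -- With `e ≤ 36 A Q / s` and a decrease of `2 / 3 * Q ^ 2 / s`, the constant is `1944 = 36 ^ 2 * 3
  -- / 2`.
  have hrate := le_div_of_sub_sq_le (e := fun k => ‖y - f k‖ ^ 2 - ‖y - h'‖ ^ 2)
    (D := 1944 * A ^ 2 / s) (by positivity) (fun k => by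
      have : ‖y - f (k + 1)‖ ^ 2 ≤ ‖y - f k‖ ^ 2 := hanti (Nat.le_succ k)
      simpa using this) ?_ hm
  · linarith
  intro k hk hek
  obtain ⟨k, rfl⟩ : ∃ l, k = l + 1 := ⟨k - 1, by omega⟩
  have hdec := H.norm_sq_le_sub (hT (k + 1)) (hTs (k + 1)).le (hblock (k + 1))
  have hortho : ⟪y - f (k + 1), f (k + 1)⟫ = 0 := by
    have h1 : ∀ w ∈ V k, ⟪y - f (k + 1), w⟫ = 0 := by
      intro w hw
      induction hw using Submodule.span_induction with
      | mem w hw =>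
        obtain ⟨i, ⟨l, hl, hi⟩, rfl⟩ := hw
        exact horth k l hl i hi
      | zero => simp
      | add u w _ _ hu hw => rw [inner_add_right, hu, hw, add_zero]
      | smul c w _ hw => rw [inner_smul_right, hw, mul_zero]
    exact h1 _ (hspan k)
  have h1 : ‖y - f (k + 1)‖ ^ 2 - ‖y - h'‖ ^ 2 ≤ 2 * ⟪y - f (k + 1), h'⟫ := by
    have : ‖y - h'‖ ^ 2 = ‖y - f (k + 1)‖ ^ 2 - 2 * ⟪y - f (k + 1), h'⟫
        + ‖h' - f (k + 1)‖ ^ 2 := by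
      rw [show y - h' = (y - f (k + 1)) - (h' - f (k + 1)) by abel, norm_sub_sq_real,
        inner_sub_right (y - f (k + 1)), hortho, sub_zero]
    nlinarith [sq_nonneg ‖h' - f (k + 1)‖]
  have hQ0 : 0 ≤ Q (k + 1) := Finset.sum_nonneg fun _ _ => abs_nonneg _
  have h2 : ⟪y - f (k + 1), h'⟫ ≤ 18 * A * Q (k + 1) / s := by
    rw [hh', inner_sum_smul, ← Finset.sum_sdiff (hT (k + 1))]
    have h3 : ∑ i ∈ T (k + 1), (if i ∈ U then 0 else a i) * ⟪y - f (k + 1), φ i⟫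
        ≤ τ * Q (k + 1) := by
      rw [hQ, Finset.mul_sum]
      refine Finset.sum_le_sum fun i hi => ?_
      -- Coefficients on the first block may be large, but the residual is orthogonal to it; all
      -- others are at most `τ`.
      by_cases hi0 : i ∈ T 0
      · rw [horth k 0 (Nat.zero_le _) i hi0]; simp
      · refine (le_abs_self _).trans ?_
        rw [abs_mul]
        refine mul_le_mul_of_nonneg_right ?_ (abs_nonneg _)
        split_ifs with hiU
        · rw [abs_zero]; positivity
        · by_contra hc
          exact hiU (Finset.mem_filter.2 ⟨hT _ hi, hi0, not_le.1 hc⟩)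
    have h4 : ∑ i ∈ I \ T (k + 1), (if i ∈ U then 0 else a i) * ⟪y - f (k + 1), φ i⟫
        ≤ Q (k + 1) / s * A := by
      refine ((le_abs_self _).trans
        (abs_sum_mul_le (θ := Q (k + 1) / s) fun i hi => ?_)).trans ?_
      · rw [Finset.mem_sdiff] at hi
        rw [le_div_iff₀ hs, mul_comm]
        have := Finset.card_nsmul_le_sum (T (k + 1)) (fun j => |⟪y - f (k + 1), φ j⟫|) _
          fun j hj => hgreedy (k + 1) j hj i hi.1 hi.2
        rwa [hTs, nsmul_eq_mul] at this
      · refine mul_le_mul_of_nonneg_left ?_ (by positivity)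
        refine le_trans (Finset.sum_le_sum fun i _ => ?_)
          (Finset.sum_le_sum_of_subset_of_nonneg Finset.sdiff_subset fun i _ _ => abs_nonneg (a i))
        split_ifs <;> simp
    have h5 : 18 * A * Q (k + 1) / s = Q (k + 1) / s * A + τ * Q (k + 1) := by rw [hτ]; ring
    linarith
  have h3 : (‖y - f (k + 1)‖ ^ 2 - ‖y - h'‖ ^ 2) ^ 2 / (1944 * A ^ 2 / s)
      ≤ 2 / 3 * Q (k + 1) ^ 2 / s := by
    have h4 : ‖y - f (k + 1)‖ ^ 2 - ‖y - h'‖ ^ 2 ≤ 36 * A * Q (k + 1) / s := by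
      have : 36 * A * Q (k + 1) / s = 2 * (18 * A * Q (k + 1) / s) := by ring
      linarith
    have h5 := pow_le_pow_left₀ hek h4 2
    rw [div_le_iff₀ (by positivity)]
    refine h5.trans (le_of_eq ?_)
    field_simp
    ring
  linarith

end GreedyRate

/-! ### Transfer to the empirical inner product -/

section Run

open scoped RealInnerProductSpace

variable {X : Type*} {n N : ℕ}

/-- The vectors of values on the sample, scaled so that `empInner` becomes the inner product of a
Euclidean space. -/
noncomputable def empVec (n : ℕ) : (Fin n → ℝ) →ₗ[ℝ] EuclideanSpace ℝ (Fin n) :=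
  (Real.sqrt (1 / (n : ℝ))) • (WithLp.linearEquiv 2 ℝ (Fin n → ℝ)).symm.toLinearMap

theorem inner_empVec (u v : Fin n → ℝ) : ⟪empVec n u, empVec n v⟫ = empInner u v := by
  have h : (0 : ℝ) ≤ 1 / n := by positivity
  have h2 : empInner u v = 1 / n * ∑ i, v i * u i := by simp [empInner, mul_comm]
  rw [h2]
  simp only [empVec, LinearMap.smul_apply, inner_smul_left, inner_smul_right]
  simp only [PiLp.inner_apply]
  rw [← mul_assoc]
  congr 1
  exact Real.mul_self_sqrt h

theorem norm_empVec_sq (u : Fin n → ℝ) : ‖empVec n u‖ ^ 2 = empInner u u := by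
  rw [← real_inner_self_eq_norm_sq, inner_empVec]

theorem empInner_self_nonneg (u : Fin n → ℝ) : 0 ≤ empInner u u := by
  rw [← norm_empVec_sq]; positivity

theorem empNorm_sq (u : Fin n → ℝ) : empNorm u ^ 2 = empInner u u :=
  Real.sq_sqrt (empInner_self_nonneg u)

/-- Evaluation of functions on the sample. -/
noncomputable def sampleEval (x : Fin n → X) : (X → ℝ) →ₗ[ℝ] EuclideanSpace ℝ (Fin n) :=
  empVec n ∘ₗ LinearMap.funLeft ℝ ℝ x

theorem sampleEval_apply (x : Fin n → X) (f : X → ℝ) :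
    sampleEval x f = empVec n fun k => f (x k) := rfl

theorem inner_sampleEval (x : Fin n → X) (u : Fin n → ℝ) (f : X → ℝ) :
    ⟪empVec n u, sampleEval x f⟫ = empInner u fun k => f (x k) := inner_empVec _ _

theorem empInner_smul_smul (a b : ℝ) (u v : Fin n → ℝ) :
    empInner (a • u) (b • v) = a * b * empInner u v := by
  rw [← inner_empVec, map_smul, map_smul, inner_smul_left, inner_smul_right, inner_empVec]
  simp [mul_assoc]

theorem empInner_atom_self {x : Fin n → X} {g : Fin N → X → ℝ} {i : Fin N}
    (hi : i ∈ active x g) :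
    empInner (fun k => atom x g i (x k)) (fun k => atom x g i (x k)) = 1 := by
  have h0 : empNorm (fun k => g i (x k)) ≠ 0 := by
    classical
    exact (Finset.mem_filter.1 hi).2
  have : (fun k => atom x g i (x k))
      = (empNorm fun k => g i (x k))⁻¹ • fun k => g i (x k) := rfl
  rw [this, empInner_smul_smul, ← empNorm_sq]
  field_simp

theorem abs_empInner_atom_le_coherence {x : Fin n → X} {g : Fin N → X → ℝ} {i j : Fin N}
    (hi : i ∈ active x g) (hj : j ∈ active x g) (hij : i ≠ j) :
    |empInner (fun k => atom x g i (x k)) (fun k => atom x g j (x k))| ≤ coherence x g := by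
  refine le_csSup ?_ ⟨i, hi, j, hj, hij, rfl⟩
  refine Set.Finite.bddAbove ?_
  refine Set.Finite.subset (Set.finite_range fun p : Fin N × Fin N =>
    |empInner (fun k => atom x g p.1 (x k)) (fun k => atom x g p.2 (x k))|) ?_
  rintro c ⟨i, -, j, -, -, rfl⟩
  exact ⟨(i, j), rfl⟩

theorem coherence_nonneg (x : Fin n → X) (g : Fin N → X → ℝ) : 0 ≤ coherence x g := by
  refine Real.sSup_nonneg ?_
  rintro c ⟨i, -, j, -, -, rfl⟩
  exact abs_nonneg _

/-- For `s = 1` the hypothesis is void and Cauchy–Schwarz gives `M = 1`; for `s ≥ 2`, `s ≤ 2 (s -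
1)` yields `M s ≤ 1`. -/
theorem isIncoherent_atom {x : Fin n → X} {g : Fin N → X → ℝ} {s : ℕ} (hs : 1 ≤ s)
    (hM : 2 * coherence x g * ((s : ℝ) - 1) ≤ 1) :
    ∃ M, IsIncoherent (fun i => sampleEval x (atom x g i)) (active x g) s M := by
  have hin : ∀ i j, ⟪sampleEval x (atom x g i), sampleEval x (atom x g j)⟫
      = empInner (fun k => atom x g i (x k)) (fun k => atom x g j (x k)) :=
    fun i j => inner_empVec _ _
  have hunit : ∀ i ∈ active x g, ⟪sampleEval x (atom x g i), sampleEval x (atom x g i)⟫ = 1 :=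
    fun i hi => by rw [hin, empInner_atom_self hi]
  rcases hs.eq_or_lt with rfl | hs2
  · refine ⟨1, hunit, zero_le_one, fun i hi j hj _ => ?_, le_rfl, by norm_num, by norm_num⟩
    refine (abs_real_inner_le_norm _ _).trans ?_
    have : ∀ i ∈ active x g, ‖sampleEval x (atom x g i)‖ = 1 := fun i hi => by
      have := hunit i hi
      rw [real_inner_self_eq_norm_sq] at this
      exact (pow_eq_one_iff_of_nonneg (norm_nonneg _) two_ne_zero).1 this
    rw [this i hi, this j hj, one_mul]
  · have h2 : (2 : ℝ) ≤ s := by exact_mod_cast hs2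
    have h0 := coherence_nonneg x g
    refine ⟨coherence x g, hunit, h0, fun i hi j hj hij => ?_, hs, hM, by nlinarith⟩
    rw [hin]
    exact abs_empInner_atom_le_coherence hi hj hij

/-- The convergence rate of the orthogonal super greedy algorithm on a sample. -/
theorem IsRun.empInner_le {x : Fin n → X} {y : Fin n → ℝ} {g : Fin N → X → ℝ} {s : ℕ}
    {T : ℕ → Finset (Fin N)} {f : ℕ → X → ℝ} (hrun : IsRun x y g s T f) (hs : 1 ≤ s)
    (hM : 2 * coherence x g * ((s : ℝ) - 1) ≤ 1) (c : Fin N → ℝ) {m : ℕ} (hm : 1 ≤ m) :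
    empInner (fun i => y i - f (m + 1) (x i)) (fun i => y i - f (m + 1) (x i))
      ≤ empInner (fun k => y k - (∑ i, c i • g i) (x k)) (fun k => y k - (∑ i, c i • g i) (x k))
        + 1944 * ((∑ i, |c i|) * ∑ i, |c i| * empInner (fun k => g i (x k)) (fun k => g i (x k)))
          / s / m := by
  classical
  obtain ⟨M, H⟩ := isIncoherent_atom hs hM
  set a : Fin N → ℝ := fun i => c i * empNorm fun k => g i (x k) with ha
  have hsub : ∀ h : X → ℝ, empVec n y - sampleEval x h = empVec n fun i => y i - h (x i) := by
    intro h
    rw [sampleEval_apply, ← map_sub]; rfl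
  have hmain := H.greedy_norm_sq_le (T := T) (f := fun k => sampleEval x (f k)) (y := empVec n y)
    (by simp [hrun.init]) (fun k => (hrun.select k).1) (fun k => (hrun.select k).2.1)
    (fun k i hi j hj hjT => by
      have := (hrun.select k).2.2 i hi j hj hjT
      simpa only [hsub, inner_sampleEval] using this)
    (fun k => by
      have := Submodule.mem_map_of_mem (f := sampleEval x) (hrun.mem_span k)
      rwa [Submodule.map_span, Set.image_image] at this)
    (fun k l hl i hi => by
      have := hrun.orthogonal k l hl i hi
      simpa only [hsub, inner_sampleEval] using this) a hm
  have hcomb : ∑ i ∈ active x g, a i • sampleEval x (atom x g i)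
      = sampleEval x (∑ i, c i • g i) := by
    rw [map_sum, ← Finset.sum_subset (Finset.subset_univ (active x g))]
    · refine Finset.sum_congr rfl fun i hi => ?_
      have h0 : empNorm (fun k => g i (x k)) ≠ 0 := (Finset.mem_filter.1 hi).2
      rw [atom, map_smul, map_smul, smul_smul, ha]
      simp only
      rw [mul_assoc, mul_inv_cancel₀ h0, mul_one]
    · intro i _ hi
      have h0 : empNorm (fun k => g i (x k)) = 0 := by
        by_contra h
        exact hi (Finset.mem_filter.2 ⟨Finset.mem_univ _, h⟩)
      have h1 : sampleEval x (g i) = 0 := by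
        rw [← norm_eq_zero, ← sq_eq_zero_iff, sampleEval_apply, norm_empVec_sq, ← empNorm_sq, h0]
        norm_num
      rw [map_smul, h1, smul_zero]
  rw [hcomb, hsub, hsub, norm_empVec_sq, norm_empVec_sq] at hmain
  refine hmain.trans ?_
  gcongr
  have h1 : ∑ i ∈ active x g, |a i| ≤ ∑ i, |a i| :=
    Finset.sum_le_sum_of_subset_of_nonneg (Finset.subset_univ _) fun _ _ _ => abs_nonneg _
  -- Cauchy–Schwarz leaves the empirical norms squared and linear, so that their expectation is
  -- available without sup-norm bounds on the dictionary.
  have h2 : (∑ i, |a i|) ^ 2 ≤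
      (∑ i, |c i|) * ∑ i, |c i| * empInner (fun k => g i (x k)) (fun k => g i (x k)) := by
    refine Finset.sum_sq_le_sum_mul_sum_of_sq_le_mul _ (fun i _ => abs_nonneg _)
      (fun i _ => mul_nonneg (abs_nonneg _) (empInner_self_nonneg _)) fun i _ => le_of_eq ?_
    rw [ha, sq_abs, mul_pow, empNorm_sq, ← sq_abs (c i)]
    ring
  exact (pow_le_pow_left₀ (Finset.sum_nonneg fun _ _ => abs_nonneg _) h1 2).trans h2

end Run

/-! ### Offset symmetrization and the one-sided deviation bound -/

section Offset

variable {Z ι γ : Type*} {n : ℕ}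

theorem two_mul_sub_sq_div_sub_le {b δ p p' : ℝ} (hb : 0 < b) (hp : |p| ≤ b) (hp' : |p'| ≤ b)
    (hδ : |p - p'| ≤ δ) : (2 * p - p ^ 2 / b) - (2 * p' - p' ^ 2 / b) ≤ 4 * δ := by
  have h1 : (2 * p - p ^ 2 / b) - (2 * p' - p' ^ 2 / b) = (p - p') * (2 - (p + p') / b) := by
    field_simp; ring
  rw [h1]
  have h2 : |2 - (p + p') / b| ≤ 4 := by
    rw [abs_le] at hp hp' ⊢
    have h3 : (p + p') / b ≤ 2 := by rw [div_le_iff₀ hb]; linarith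
    have h4 : -2 ≤ (p + p') / b := by rw [le_div_iff₀ hb]; linarith
    constructor <;> linarith
  calc (p - p') * (2 - (p + p') / b) ≤ |p - p'| * |2 - (p + p') / b| := by
        rw [← abs_mul]; exact le_abs_self _
    _ ≤ δ * 4 := mul_le_mul hδ h2 (abs_nonneg _) ((abs_nonneg _).trans hδ)
    _ = 4 * δ := by ring

/-- Splitting the quadratic term evenly between `p` and `q` gives exponents `η (±Δ - S)`, with sum
of exponentials `2 cosh (η Δ) e ^ (-η S)`. As `cosh t ≤ e ^ (t ^ 2 / 2)` and `Δ ^ 2 ≤ 25 b S`, the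
given `η` makes the offset exactly compensate. -/
theorem exp_add_exp_offset_le {b η p q : ℝ} (hb : 0 < b) (hp : |p| ≤ b) (hq : |q| ≤ b)
    (hη : η = 2 / (25 * b)) :
    Real.exp (η * (2 * p - p ^ 2 / b - 2 * q)) + Real.exp (η * (2 * q - q ^ 2 / b - 2 * p))
      ≤ 2 := by
  have hη0 : 0 < η := by rw [hη]; positivity
  set S := (p ^ 2 + q ^ 2) / (2 * b) with hS
  set Δ := (2 * p - p ^ 2 / (2 * b)) - (2 * q - q ^ 2 / (2 * b)) with hΔ
  have e1 : 2 * p - p ^ 2 / b - 2 * q = Δ - S := by rw [hΔ, hS]; field_simp; ring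
  have e2 : 2 * q - q ^ 2 / b - 2 * p = -Δ - S := by rw [hΔ, hS]; field_simp; ring
  have hu : ∀ t : ℝ, |t| ≤ b → (2 * t - t ^ 2 / (2 * b)) ^ 2 ≤ 25 / 4 * t ^ 2 := by
    intro t ht
    have h1 : 2 * t - t ^ 2 / (2 * b) = t * (2 - t / (2 * b)) := by field_simp
    have h2 : (2 - t / (2 * b)) ^ 2 ≤ 25 / 4 := by
      rw [abs_le] at ht
      have h3 : t / (2 * b) ≤ 1 / 2 := by rw [div_le_iff₀ (by positivity)]; linarith
      have h4 : -(1 / 2) ≤ t / (2 * b) := by rw [le_div_iff₀ (by positivity)]; linarith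
      nlinarith
    rw [h1, mul_pow]
    nlinarith [sq_nonneg t]
  have hΔS : Δ ^ 2 ≤ 25 * b * S := by
    have h1 := hu p hp
    have h2 := hu q hq
    have h3 : 25 * b * S = 25 / 2 * (p ^ 2 + q ^ 2) := by rw [hS]; field_simp
    rw [h3, hΔ]
    nlinarith [sq_nonneg ((2 * p - p ^ 2 / (2 * b)) + (2 * q - q ^ 2 / (2 * b)))]
  have h1 : Real.exp (η * (Δ - S)) + Real.exp (η * (-Δ - S))
      = 2 * Real.cosh (η * Δ) * Real.exp (-(η * S)) := by
    rw [Real.cosh_eq, show η * (Δ - S) = η * Δ + -(η * S) by ring,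
      show η * (-Δ - S) = -(η * Δ) + -(η * S) by ring, Real.exp_add, Real.exp_add]
    ring
  rw [e1, e2, h1]
  have h2 := Real.cosh_le_exp_half_sq (η * Δ)
  have h3 : (η * Δ) ^ 2 / 2 ≤ η * S := by
    have : (η * Δ) ^ 2 ≤ η ^ 2 * (25 * b * S) := by
      rw [mul_pow]; exact mul_le_mul_of_nonneg_left hΔS (sq_nonneg _)
    have h4 : η ^ 2 * (25 * b * S) = 2 * (η * S) := by
      have : η * (25 * b) = 2 := by rw [hη]; field_simp
      calc η ^ 2 * (25 * b * S) = η * (η * (25 * b)) * S := by ring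
        _ = _ := by rw [this]; ring
    linarith
  calc 2 * Real.cosh (η * Δ) * Real.exp (-(η * S))
      ≤ 2 * Real.exp (η * S) * Real.exp (-(η * S)) := by
        gcongr
        exact h2.trans (Real.exp_le_exp.2 h3)
    _ = 2 := by rw [mul_assoc, ← Real.exp_add]; simp

/-- The offset deviation of the function `l` on a sample and a ghost sample, listed as pairs. -/
noncomputable def offsetDev (b : ℝ) (l : Z → ℝ) (w : Fin n → Z × Z) : ℝ :=
  1 / (n : ℝ) * ∑ k, (2 * l (w k).2 - l (w k).2 ^ 2 / b - 2 * l (w k).1)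

/-- Exchange sample and ghost sample in the coordinates selected by `σ`. -/
def swapOn (σ : Fin n → Bool) (w : Fin n → Z × Z) (k : Fin n) : Z × Z :=
  (if σ k then id else Prod.swap) (w k)

/-- The sum over exchanges factors over the coordinates, and each factor is at most `2`. -/
theorem sum_exp_offsetDev_le {b η : ℝ} (hb : 0 < b) (hn : 0 < n) (hη : η = 2 / (25 * b))
    {l : Z → ℝ} (hl : ∀ z, |l z| ≤ b) (w : Fin n → Z × Z) :
    ∑ σ : Fin n → Bool, Real.exp (η * n * offsetDev b l (swapOn σ w)) ≤ 2 ^ n := by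
  have hn' : (n : ℝ) ≠ 0 := by positivity
  set F : Fin n → Bool → ℝ := fun k c =>
    Real.exp (η * (2 * l ((if c then id else Prod.swap) (w k)).2
      - l ((if c then id else Prod.swap) (w k)).2 ^ 2 / b
      - 2 * l ((if c then id else Prod.swap) (w k)).1)) with hF
  have h1 : ∀ σ : Fin n → Bool, Real.exp (η * n * offsetDev b l (swapOn σ w))
      = ∏ k, F k (σ k) := by
    intro σ
    rw [hF, ← Real.exp_sum, ← Finset.mul_sum]
    congr 1
    rw [offsetDev, ← mul_assoc, mul_assoc η, mul_one_div_cancel hn', mul_one]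
    rfl
  simp_rw [h1]
  rw [← Fintype.prod_sum]
  refine (Finset.prod_le_prod (g := fun _ => (2 : ℝ)) (fun k _ => ?_) fun k _ => ?_).trans
    (by simp)
  · exact Finset.sum_nonneg fun _ _ => (Real.exp_pos _).le
  · simp only [hF, Fintype.sum_bool, if_true, id, Bool.false_eq_true, if_false, Prod.fst_swap,
      Prod.snd_swap]
    exact exp_add_exp_offset_le hb (hl _) (hl _) hη

theorem offsetDev_le {b : ℝ} (hb : 0 < b) (hn : 0 < n) {l : Z → ℝ} (hl : ∀ z, |l z| ≤ b)
    (w : Fin n → Z × Z) : offsetDev b l w ≤ 4 * b := by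
  have hn' : (0 : ℝ) < n := by positivity
  have : ∑ k, (2 * l (w k).2 - l (w k).2 ^ 2 / b - 2 * l (w k).1) ≤ ∑ _k : Fin n, 4 * b := by
    refine Finset.sum_le_sum fun k _ => ?_
    have h1 := abs_le.1 (hl (w k).2)
    have h2 := abs_le.1 (hl (w k).1)
    have h3 : 0 ≤ l (w k).2 ^ 2 / b := by positivity
    linarith
  rw [Finset.sum_const, Finset.card_univ, Fintype.card_fin, nsmul_eq_mul] at this
  rw [offsetDev, one_div, inv_mul_le_iff₀ hn']
  exact this

theorem offsetDev_sub_le {b δ : ℝ} (hb : 0 < b) (hn : 0 < n) {l l' : Z → ℝ} (hl : ∀ z, |l z| ≤ b)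
    (hl' : ∀ z, |l' z| ≤ b) {w : Fin n → Z × Z}
    (h : ∀ k, |l (w k).1 - l' (w k).1| ≤ δ ∧ |l (w k).2 - l' (w k).2| ≤ δ) :
    offsetDev b l w - offsetDev b l' w ≤ 6 * δ := by
  have hn' : (0 : ℝ) < n := by positivity
  rw [offsetDev, offsetDev, ← mul_sub, ← Finset.sum_sub_distrib, one_div, inv_mul_le_iff₀ hn']
  have : ∑ k, ((2 * l (w k).2 - l (w k).2 ^ 2 / b - 2 * l (w k).1)
      - (2 * l' (w k).2 - l' (w k).2 ^ 2 / b - 2 * l' (w k).1)) ≤ ∑ _k : Fin n, 6 * δ := by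
    refine Finset.sum_le_sum fun k _ => ?_
    have h1 := two_mul_sub_sq_div_sub_le hb (hl (w k).2) (hl' (w k).2) (h k).2
    have h2 := abs_le.1 (h k).1
    linarith
  rwa [Finset.sum_const, Finset.card_univ, Fintype.card_fin, nsmul_eq_mul] at this

/-- The supremum of the penalized offset deviations. -/
noncomputable def offsetSup (b : ℝ) (l : ι → Z → ℝ) (pen : ι → ℝ) (w : Fin n → Z × Z) : ℝ :=
  max 0 (⨆ i, (offsetDev b (l i) w - pen i))

/-- `τ` sorts the functions `l i` into the cells `C`, with penalties at least `pc`, such that any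
two functions in a cell differ by at most `δ` on the points of `w`. -/
structure IsCellMap (l : ι → Z → ℝ) (pen : ι → ℝ) (δ : ℝ) (w : Fin n → Z × Z) (C : Finset γ)
    (τ : ι → γ) (pc : γ → ℝ) : Prop where
  mem : ∀ i, τ i ∈ C
  le : ∀ i, pc (τ i) ≤ pen i
  close : ∀ i j, τ i = τ j → ∀ k, |l i (w k).1 - l j (w k).1| ≤ δ ∧ |l i (w k).2 - l j (w k).2| ≤ δ

/-- Closeness within a cell is unaffected by exchanges, so the same cells and representatives serve
all `σ`. Passing to a representative costs `6 δ`; the maximum over cells is bounded by a sum of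
exponentials through `x ≤ e ^ x`. -/
theorem sum_offsetSup_le [Nonempty ι] {b η δ A : ℝ} (hb : 0 < b) (hn : 0 < n) (hδ : 0 ≤ δ)
    (hη : η = 2 / (25 * b)) {l : ι → Z → ℝ} (hl : ∀ i z, |l i z| ≤ b) {pen : ι → ℝ}
    {w : Fin n → Z × Z} {C : Finset γ} {τ : ι → γ} {pc : γ → ℝ}
    (hC : IsCellMap l pen δ w C τ pc) (hA : ∑ c ∈ C, Real.exp (-(η * n * pc c)) ≤ A) :
    ∑ σ : Fin n → Bool, offsetSup b l pen (swapOn σ w) ≤ 2 ^ n * (6 * δ + A / (η * n)) := by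
  have hη0 : 0 < η := by rw [hη]; positivity
  have hηn : 0 < η * n := by positivity
  have hself : ∀ (σ : Fin n → Bool) i, offsetDev b (l i) (swapOn σ w) - pen i ≤
      6 * δ + 1 / (η * n) * ∑ c ∈ C, Real.exp (-(η * n * pc c))
        * Real.exp (η * n * offsetDev b (l (Function.invFun τ c)) (swapOn σ w)) := by
    intro σ i
    set j := Function.invFun τ (τ i) with hj
    have hij : τ i = τ j := (Function.invFun_eq ⟨i, rfl⟩).symm
    have h1 : offsetDev b (l i) (swapOn σ w) - offsetDev b (l j) (swapOn σ w) ≤ 6 * δ := by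
      refine offsetDev_sub_le hb hn (hl i) (hl j) fun k => ?_
      have := hC.close i j hij k
      unfold swapOn
      split_ifs
      · exact this
      · exact this.symm
    have h2 : offsetDev b (l j) (swapOn σ w) - pc (τ i) ≤ 1 / (η * n) *
        (Real.exp (-(η * n * pc (τ i))) * Real.exp (η * n * offsetDev b (l j) (swapOn σ w))) := by
      rw [← Real.exp_add, one_div, le_inv_mul_iff₀ hηn]
      have := Real.add_one_le_exp
        (-(η * n * pc (τ i)) + η * n * offsetDev b (l j) (swapOn σ w))
      linarith
    have h3 : Real.exp (-(η * n * pc (τ i))) * Real.exp (η * n * offsetDev b (l j) (swapOn σ w))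
        ≤ ∑ c ∈ C, Real.exp (-(η * n * pc c))
          * Real.exp (η * n * offsetDev b (l (Function.invFun τ c)) (swapOn σ w)) :=
      Finset.single_le_sum (f := fun c => Real.exp (-(η * n * pc c))
          * Real.exp (η * n * offsetDev b (l (Function.invFun τ c)) (swapOn σ w)))
        (fun c _ => by positivity) (hC.mem i)
    have h4 := mul_le_mul_of_nonneg_left h3 (one_div_pos.2 hηn).le
    have h5 := hC.le i
    linarith
  have hsup : ∀ σ : Fin n → Bool, offsetSup b l pen (swapOn σ w) ≤
      6 * δ + 1 / (η * n) * ∑ c ∈ C, Real.exp (-(η * n * pc c))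
        * Real.exp (η * n * offsetDev b (l (Function.invFun τ c)) (swapOn σ w)) := fun σ =>
    max_le (by positivity) (ciSup_le (hself σ))
  refine (Finset.sum_le_sum fun σ _ => hsup σ).trans ?_
  have h1 : ∑ c ∈ C, Real.exp (-(η * n * pc c)) * ∑ σ : Fin n → Bool,
      Real.exp (η * n * offsetDev b (l (Function.invFun τ c)) (swapOn σ w)) ≤ A * 2 ^ n := by
    refine le_trans ?_ (mul_le_mul_of_nonneg_right hA (by positivity))
    rw [Finset.sum_mul]
    exact Finset.sum_le_sum fun c _ =>
      mul_le_mul_of_nonneg_left (sum_exp_offsetDev_le hb hn hη (hl _) w) (Real.exp_pos _).le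
  have h2 : ∑ _σ : Fin n → Bool, 6 * δ = 2 ^ n * (6 * δ) := by simp
  have h3 := mul_le_mul_of_nonneg_left h1 (one_div_pos.2 hηn).le
  rw [Finset.sum_add_distrib, h2, ← Finset.mul_sum, Finset.sum_comm,
    Finset.sum_congr rfl fun c _ => (Finset.mul_sum _ _ _).symm]
  have h4 : 1 / (η * n) * (A * 2 ^ n) = 2 ^ n * (A / (η * n)) := by ring
  linarith

theorem bddAbove_offsetDev_sub {b : ℝ} (hb : 0 < b) (hn : 0 < n) {l : ι → Z → ℝ}
    (hl : ∀ i z, |l i z| ≤ b) {pen : ι → ℝ} (hpen : ∀ i, 0 ≤ pen i) (w : Fin n → Z × Z) :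
    BddAbove (Set.range fun i => offsetDev b (l i) w - pen i) := by
  refine ⟨4 * b, ?_⟩
  rintro _ ⟨i, rfl⟩
  have h1 := offsetDev_le hb hn (hl i) w
  have h2 := hpen i
  simp only
  linarith

/-- The lower bound comes from the `max 0`, as the penalties have no upper bound. -/
theorem norm_offsetSup_le [Nonempty ι] {b : ℝ} (hb : 0 < b) (hn : 0 < n) {l : ι → Z → ℝ}
    (hl : ∀ i z, |l i z| ≤ b) {pen : ι → ℝ} (hpen : ∀ i, 0 ≤ pen i) (w : Fin n → Z × Z) :
    ‖offsetSup b l pen w‖ ≤ 4 * b := by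
  rw [offsetSup, Real.norm_of_nonneg (le_max_left _ _)]
  refine max_le (by positivity) (ciSup_le fun i => ?_)
  have h1 := offsetDev_le hb hn (hl i) w
  have h2 := hpen i
  linarith

variable [MeasurableSpace Z]

theorem measurable_offsetDev (b : ℝ) {l : Z → ℝ} (hl : Measurable l) :
    Measurable (offsetDev b l : (Fin n → Z × Z) → ℝ) := by
  unfold offsetDev
  fun_prop

theorem measurable_offsetSup [Countable ι] (b : ℝ) {l : ι → Z → ℝ} (hl : ∀ i, Measurable (l i))
    (pen : ι → ℝ) : Measurable (offsetSup b l pen : (Fin n → Z × Z) → ℝ) :=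
  measurable_const.max (Measurable.iSup fun i => (measurable_offsetDev b (hl i)).sub_const _)

theorem measurePreserving_swapOn (P : Measure Z) [IsProbabilityMeasure P] (σ : Fin n → Bool) :
    MeasurePreserving (swapOn σ) (Measure.pi fun _ : Fin n => P.prod P)
      (Measure.pi fun _ : Fin n => P.prod P) := by
  refine measurePreserving_pi (fun _ => P.prod P) (fun _ => P.prod P)
    (f := fun k => if σ k then id else Prod.swap) fun k => ?_
  split_ifs
  · exact MeasurePreserving.id _
  · exact Measure.measurePreserving_swap

/-- Symmetrization by the coordinatewise exchange of sample and ghost sample. -/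
theorem integral_offsetSup_le [Nonempty ι] [Countable ι] (P : Measure Z) [IsProbabilityMeasure P]
    {b η δ A : ℝ} (hb : 0 < b) (hn : 0 < n) (hδ : 0 ≤ δ)
    (hη : η = 2 / (25 * b)) {l : ι → Z → ℝ} (hl : ∀ i z, |l i z| ≤ b)
    (hlm : ∀ i, Measurable (l i)) {pen : ι → ℝ} (hpen : ∀ i, 0 ≤ pen i)
    (hC : ∀ w : Fin n → Z × Z, ∃ (C : Finset γ) (τ : ι → γ) (pc : γ → ℝ),
      IsCellMap l pen δ w C τ pc ∧ ∑ c ∈ C, Real.exp (-(η * n * pc c)) ≤ A) :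
    ∫ w, offsetSup b l pen w ∂(Measure.pi fun _ : Fin n => P.prod P)
      ≤ 6 * δ + A / (η * n) := by
  set Q := Measure.pi fun _ : Fin n => P.prod P
  have hmeas := measurable_offsetSup (n := n) b hlm pen
  have hint : ∀ σ : Fin n → Bool, Integrable (fun w => offsetSup b l pen (swapOn σ w)) Q :=
    fun σ => Integrable.of_bound
      (hmeas.comp (measurePreserving_swapOn P σ).measurable).aestronglyMeasurable (4 * b)
      (Filter.Eventually.of_forall fun w => norm_offsetSup_le hb hn hl hpen _)
  have hswap : ∀ σ : Fin n → Bool, ∫ w, offsetSup b l pen (swapOn σ w) ∂Q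
      = ∫ w, offsetSup b l pen w ∂Q := by
    intro σ
    have h := measurePreserving_swapOn (n := n) P σ
    have h2 := integral_map (μ := Q) h.measurable.aemeasurable
      (f := offsetSup b l pen) hmeas.aestronglyMeasurable
    rw [h.map_eq] at h2
    exact h2.symm
  have h1 : ∑ σ : Fin n → Bool, ∫ w, offsetSup b l pen (swapOn σ w) ∂Q
      = 2 ^ n * ∫ w, offsetSup b l pen w ∂Q := by
    simp_rw [hswap]; simp
  rw [← integral_finsetSum _ fun σ _ => hint σ] at h1
  have h2 : ∫ w, ∑ σ : Fin n → Bool, offsetSup b l pen (swapOn σ w) ∂Q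
      ≤ ∫ _w, 2 ^ n * (6 * δ + A / (η * n)) ∂Q := by
    refine integral_mono (integrable_finsetSum _ fun σ _ => hint σ) (integrable_const _) fun w => ?_
    obtain ⟨C, τ, pc, hcell, hA⟩ := hC w
    exact sum_offsetSup_le hb hn hδ hη hl hcell hA
  rw [integral_const, probReal_univ, one_smul, h1] at h2
  exact le_of_mul_le_mul_left h2 (by positivity)

theorem integrable_comp_of_bound {P : Measure Z} [IsProbabilityMeasure P] {l : Z → ℝ} {b : ℝ}
    (hlm : Measurable l) (hl : ∀ z, |l z| ≤ b) : Integrable l P :=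
  Integrable.of_bound hlm.aestronglyMeasurable b (Filter.Eventually.of_forall hl)

theorem integral_empirical (P : Measure Z) [IsProbabilityMeasure P] (hn : 0 < n) {q : Z → ℝ}
    (hq : Integrable q P) :
    Integrable (fun z : Fin n → Z => 1 / (n : ℝ) * ∑ k, q (z k)) (Measure.pi fun _ : Fin n => P) ∧
    ∫ z, 1 / (n : ℝ) * ∑ k, q (z k) ∂(Measure.pi fun _ : Fin n => P) = ∫ z, q z ∂P := by
  have h : ∀ k : Fin n, Integrable (fun z : Fin n → Z => q (z k)) (Measure.pi fun _ => P) :=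
    fun k => integrable_comp_eval (μ := fun _ : Fin n => P) hq
  refine ⟨(integrable_finsetSum _ fun k _ => h k).const_mul _, ?_⟩
  rw [integral_const_mul, integral_finsetSum _ fun k _ => h k]
  have : ∀ k : Fin n, ∫ z : Fin n → Z, q (z k) ∂(Measure.pi fun _ => P) = ∫ z, q z ∂P :=
    fun k => integral_comp_eval (μ := fun _ : Fin n => P) hq.aestronglyMeasurable
  simp_rw [this]
  have hn' : (n : ℝ) ≠ 0 := by positivity
  simp only [Finset.sum_const, Finset.card_univ, Fintype.card_fin, nsmul_eq_mul]
  field_simp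

/-- A uniform one-sided ratio bound for the deviation of means from empirical means, for classes of
functions whose second moments are bounded by their means. -/
theorem exists_integral_sub_le [Nonempty ι] [Countable ι] (P : Measure Z) [IsProbabilityMeasure P]
    {b η δ A : ℝ} (hb : 0 < b) (hn : 0 < n) (hδ : 0 ≤ δ)
    (hη : η = 2 / (25 * b)) {l : ι → Z → ℝ} (hl : ∀ i z, |l i z| ≤ b)
    (hlm : ∀ i, Measurable (l i)) (hvar : ∀ i, ∫ z, l i z ^ 2 ∂P ≤ b * ∫ z, l i z ∂P)
    {pen : ι → ℝ} (hpen : ∀ i, 0 ≤ pen i)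
    (hC : ∀ w : Fin n → Z × Z, ∃ (C : Finset γ) (τ : ι → γ) (pc : γ → ℝ),
      IsCellMap l pen δ w C τ pc ∧ ∑ c ∈ C, Real.exp (-(η * n * pc c)) ≤ A) :
    ∃ G : (Fin n → Z) → ℝ, Integrable G (Measure.pi fun _ => P) ∧
      ∫ z, G z ∂(Measure.pi fun _ => P) ≤ 6 * δ + A / (η * n) ∧
      ∀ z i, ∫ u, l i u ∂P - 2 * (1 / (n : ℝ) * ∑ k, l i (z k)) - pen i ≤ G z := by
  set Pn := Measure.pi fun _ : Fin n => P
  have hmeas := measurable_offsetSup (n := n) b hlm pen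
  have hpres := measurePreserving_arrowProdEquivProdArrow Z Z (Fin n) (fun _ => P) (fun _ => P)
  set e := MeasurableEquiv.arrowProdEquivProdArrow Z Z (Fin n)
  have hsymm : ∀ z z' : Fin n → Z, e.symm (z, z') = fun k => (z k, z' k) := fun z z' => rfl
  have hHm : Measurable fun p => offsetSup b l pen (e.symm p) := hmeas.comp e.symm.measurable
  have hHint : Integrable (fun p => offsetSup b l pen (e.symm p)) (Pn.prod Pn) :=
    Integrable.of_bound hHm.aestronglyMeasurable (4 * b)
      (Filter.Eventually.of_forall fun w => norm_offsetSup_le hb hn hl hpen _)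
  -- `G` averages the supremum over the ghost sample; the average for a single `i` lies below it.
  refine ⟨fun z => ∫ z', offsetSup b l pen (e.symm (z, z')) ∂Pn, hHint.integral_prod_left, ?_, ?_⟩
  · have h1 := (MeasurePreserving.symm e hpres).integral_comp' (offsetSup b l pen)
    rw [← integral_prod _ hHint, h1]
    exact integral_offsetSup_le P hb hn hδ hη hl hlm hpen hC
  · intro z i
    have hsq : Integrable (fun u => l i u ^ 2) P :=
      integrable_comp_of_bound (b := b ^ 2) ((hlm i).pow_const 2) fun u => by
        rw [abs_pow]; exact pow_le_pow_left₀ (abs_nonneg _) (hl i u) 2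
    have hli := integrable_comp_of_bound (P := P) (hlm i) (hl i)
    have hu : Integrable (fun u => 2 * l i u - l i u ^ 2 / b) P :=
      (hli.const_mul 2).sub (hsq.div_const b)
    obtain ⟨h1, h2⟩ := integral_empirical (n := n) P hn hu
    have h3 : ∀ z', offsetDev b (l i) (e.symm (z, z')) - pen i
        = 1 / (n : ℝ) * ∑ k, (2 * l i (z' k) - l i (z' k) ^ 2 / b)
          - (2 * (1 / (n : ℝ) * ∑ k, l i (z k)) + pen i) := by
      intro z'
      simp only [offsetDev, hsymm, Finset.sum_sub_distrib, ← Finset.mul_sum]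
      ring
    have h4 : ∫ z', (offsetDev b (l i) (e.symm (z, z')) - pen i) ∂Pn
        = 2 * ∫ u, l i u ∂P - (∫ u, l i u ^ 2 ∂P) / b
          - (2 * (1 / (n : ℝ) * ∑ k, l i (z k)) + pen i) := by
      simp_rw [h3]
      rw [integral_sub h1 (integrable_const _), h2, integral_const, probReal_univ, one_smul,
        integral_sub (hli.const_mul 2) (hsq.div_const b), integral_const_mul, integral_div]
    have h5 : ∫ z', (offsetDev b (l i) (e.symm (z, z')) - pen i) ∂Pn
        ≤ ∫ z', offsetSup b l pen (e.symm (z, z')) ∂Pn := by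
      refine integral_mono ?_ ?_ fun z' => ?_
      · simp_rw [h3]
        exact h1.sub (integrable_const _)
      · exact Integrable.of_bound (hHm.comp measurable_prodMk_left).aestronglyMeasurable (4 * b)
          (Filter.Eventually.of_forall fun w => norm_offsetSup_le hb hn hl hpen _)
      · exact (le_ciSup (bddAbove_offsetDev_sub hb hn hl hpen _) i).trans (le_max_right _ _)
    -- The moment condition: the offset consumes at most one of the two copies of the mean.
    have h6 : (∫ u, l i u ^ 2 ∂P) / b ≤ ∫ u, l i u ∂P := by
      rw [div_le_iff₀ hb, mul_comm]; exact hvar i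
    simp only
    linarith

end Offset

/-! ### Counting threshold patterns of linear combinations -/

section Patterns

variable {α ι : Type*} [Fintype α]

open Classical in
/-- The points at which the linear combination `∑ i ∈ S, c i * E · i` exceeds the threshold `t`. -/
noncomputable def pattern (E : α → ι → ℝ) (t : α → ℝ) (S : Finset ι) (c : ι → ℝ) : Finset α :=
  Finset.univ.filter fun p => t p < ∑ i ∈ S, c i * E p i

theorem mem_pattern {E : α → ι → ℝ} {t : α → ℝ} {S : Finset ι} {c : ι → ℝ} {p : α} :
    p ∈ pattern E t S c ↔ t p < ∑ i ∈ S, c i * E p i := by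
  simp [pattern]

open Classical in
/-- All patterns of linear combinations. -/
noncomputable def patterns (E : α → ι → ℝ) (t : α → ℝ) (S : Finset ι) : Finset (Finset α) :=
  Finset.univ.filter fun A => ∃ c, A = pattern E t S c

theorem pattern_mem_patterns (E : α → ι → ℝ) (t : α → ℝ) (S : Finset ι) (c : ι → ℝ) :
    pattern E t S c ∈ patterns E t S := by
  simp only [patterns, Finset.mem_filter, Finset.mem_univ, true_and]
  exact ⟨c, rfl⟩

theorem card_le_of_shatters [DecidableEq α] {E : α → ι → ℝ} {t : α → ℝ} {S : Finset ι}
    {A : Finset α} (hA : (patterns E t S).Shatters A) : A.card ≤ S.card := by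
  classical
  by_contra! hlt
  let Φ : (A → ℝ) →ₗ[ℝ] (S → ℝ) :=
    { toFun := fun x i => ∑ p : A, x p * E p i
      map_add' := fun x y => by
        funext i; simp [add_mul, Finset.sum_add_distrib]
      map_smul' := fun r x => by
        funext i; simp [mul_assoc, Finset.mul_sum] }
  have hker : LinearMap.ker Φ ≠ ⊥ := Φ.ker_ne_bot_of_finrank_lt (by simpa using hlt)
  obtain ⟨x, hx, hx0⟩ := (Submodule.ne_bot_iff _).1 hker
  have key : ∀ x : A → ℝ, Φ x = 0 →
      ∑ p : A, x p * t p ≤ 0 ∧ ((∃ p, 0 < x p) → ∑ p : A, x p * t p < 0) := by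
    intro x hx
    obtain ⟨B, hB, hAB⟩ := hA (t := A.filter fun p => ∃ h : p ∈ A, 0 < x ⟨p, h⟩)
      (Finset.filter_subset _ _)
    obtain ⟨c, rfl⟩ := (Finset.mem_filter.1 hB).2
    have hzero : ∑ p : A, x p * ∑ i ∈ S, c i * E p i = 0 := by
      have h1 : ∀ i : S, ∑ p : A, x p * E p i = 0 := fun i => congrFun hx i
      have h2 : ∑ p : A, x p * ∑ i ∈ S, c i * E p i
          = ∑ i ∈ S, c i * ∑ p : A, x p * E p i := by
        simp_rw [Finset.mul_sum]
        rw [Finset.sum_comm]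
        exact Finset.sum_congr rfl fun i _ => Finset.sum_congr rfl fun p _ => by ring
      rw [h2]
      exact Finset.sum_eq_zero fun i hi => by rw [h1 ⟨i, hi⟩, mul_zero]
    have hiff : ∀ p : A, t p < ∑ i ∈ S, c i * E p i ↔ 0 < x p := by
      intro p
      have := Finset.ext_iff.1 hAB p
      simpa [mem_pattern] using this
    have hterm : ∀ p : A, x p * t p ≤ x p * ∑ i ∈ S, c i * E p i := by
      intro p
      rcases lt_or_ge 0 (x p) with h | h
      · exact mul_le_mul_of_nonneg_left ((hiff p).2 h).le h.le
      · exact mul_le_mul_of_nonpos_left (not_lt.1 fun h' => (not_lt.2 h) ((hiff p).1 h')) h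
    refine ⟨(Finset.sum_le_sum fun p _ => hterm p).trans_eq hzero, fun ⟨p, hp⟩ => ?_⟩
    exact (Finset.sum_lt_sum (fun p _ => hterm p)
      ⟨p, Finset.mem_univ _, mul_lt_mul_of_pos_left ((hiff p).2 hp) hp⟩).trans_eq hzero
  have h1 := key x hx
  have h2 := key (-x) (by rw [map_neg, LinearMap.mem_ker.1 hx, neg_zero])
  simp only [Pi.neg_apply, neg_mul, Finset.sum_neg_distrib] at h2
  refine hx0 (funext fun p => ?_)
  rcases lt_trichotomy (x p) 0 with h | h | h
  · have := h2.2 ⟨p, by linarith⟩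
    linarith [h1.1]
  · exact h
  · have := h1.2 ⟨p, h⟩
    linarith [h2.1]

/-- Sauer–Shelah, with the sum of binomial coefficients bounded by a binomial expansion. -/
theorem card_patterns_le (E : α → ι → ℝ) (t : α → ℝ) (S : Finset ι) :
    (patterns E t S).card ≤ (Fintype.card α + 1) ^ S.card := by
  classical
  have hvc : (patterns E t S).vcDim ≤ S.card :=
    Finset.sup_le fun A hA => card_le_of_shatters (Finset.mem_shatterer.1 hA)
  calc (patterns E t S).card ≤ (patterns E t S).shatterer.card := Finset.card_le_card_shatterer _
    _ ≤ ∑ k ∈ Finset.Iic (patterns E t S).vcDim, (Fintype.card α).choose k :=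
        Finset.card_shatterer_le_sum_vcDim
    _ ≤ ∑ k ∈ Finset.range (S.card + 1), (Fintype.card α).choose k := by
        refine Finset.sum_le_sum_of_subset fun k hk => ?_
        rw [Finset.mem_Iic] at hk
        rw [Finset.mem_range]; omega
    _ ≤ ∑ k ∈ Finset.range (S.card + 1), Fintype.card α ^ k * 1 ^ (S.card - k) * S.card.choose k := by
        refine Finset.sum_le_sum fun k hk => ?_
        rw [Finset.mem_range] at hk
        have h1 : 1 ≤ S.card.choose k := Nat.choose_pos (by omega)
        have h2 := Nat.choose_le_pow (Fintype.card α) k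
        rw [one_pow, mul_one]
        exact h2.trans (Nat.le_mul_of_pos_right _ h1)
    _ = (Fintype.card α + 1) ^ S.card := (add_pow _ _ _).symm

end Patterns

/-! ### Truncation and its discretization -/

theorem trunc_eq {L : ℝ} (hL : 0 ≤ L) (u : ℝ) : trunc L u = max (-L) (min L u) := by
  rw [trunc]
  rcases lt_trichotomy u 0 with h | h | h
  · rw [Real.sign_of_neg h, abs_of_neg h, min_eq_right (h.le.trans hL)]
    rcases le_total L (-u) with h1 | h1
    · rw [min_eq_left h1, max_eq_left (by linarith)]; ring
    · rw [min_eq_right h1, max_eq_right (by linarith)]; ring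
  · simp [h, hL]
  · rw [Real.sign_of_pos h, abs_of_pos h, mul_one, max_eq_right]
    exact le_min (by linarith) (by linarith)

theorem abs_trunc_le {L : ℝ} (hL : 0 ≤ L) (u : ℝ) : |trunc L u| ≤ L := by
  rw [trunc_eq hL, abs_le]
  exact ⟨le_max_left _ _, max_le (by linarith) (min_le_left _ _)⟩

theorem continuous_trunc {L : ℝ} (hL : 0 ≤ L) : Continuous (trunc L) := by
  have : trunc L = fun u => max (-L) (min L u) := funext (trunc_eq hL)
  rw [this]; fun_prop

theorem trunc_of_abs_le {L u : ℝ} (h : |u| ≤ L) : trunc L u = u := by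
  have h' := abs_le.1 h
  rw [trunc_eq ((abs_nonneg _).trans h), min_eq_right h'.2, max_eq_right h'.1]

theorem abs_sub_trunc_le {L y : ℝ} (hy : |y| ≤ L) (u : ℝ) : |y - trunc L u| ≤ |y - u| := by
  have h := abs_le.1 hy
  rw [trunc_eq ((abs_nonneg _).trans hy)]
  rcases le_total L u with h1 | h1
  · rw [min_eq_left h1, max_eq_right (by linarith), abs_of_nonpos (by linarith),
      abs_of_nonpos (by linarith)]
    linarith
  · rw [min_eq_right h1]
    rcases le_total (-L) u with h2 | h2
    · rw [max_eq_right h2]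
    · rw [max_eq_left h2, abs_of_nonneg (by linarith), abs_of_nonneg (by linarith)]
      linarith

/-- The `j`-th of the equidistant thresholds in `[-L, L]`. -/
noncomputable def threshold (L : ℝ) (n j : ℕ) : ℝ := -L + j * (2 * L / n)

theorem trunc_sub_trunc_le {L : ℝ} (hL : 0 < L) {n : ℕ} (hn : 0 < n) {v v' : ℝ}
    (h : ∀ j : Fin (n + 1), threshold L n j < v → threshold L n j < v') :
    trunc L v - trunc L v' ≤ 2 * L / n := by
  have hn' : (0 : ℝ) < n := by positivity
  have hstep : 0 < 2 * L / n := by positivity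
  by_contra! hc
  have hv := abs_le.1 (abs_trunc_le hL.le v)
  have hv' := abs_le.1 (abs_trunc_le hL.le v')
  set q := (trunc L v' + L) / (2 * L / n) with hq
  have hq0 : 0 ≤ q := div_nonneg (by linarith) hstep.le
  -- The first threshold at or above `trunc L v'`; a gap larger than the spacing puts it strictly
  -- below `trunc L v`.
  set j := ⌈q⌉₊ with hj
  have hqv : q * (2 * L / n) = trunc L v' + L := div_mul_cancel₀ _ hstep.ne'
  have hj1 : trunc L v' ≤ threshold L n j := by
    have : q * (2 * L / n) ≤ j * (2 * L / n) :=
      mul_le_mul_of_nonneg_right (Nat.le_ceil q) hstep.le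
    rw [threshold]; linarith
  have hj2 : threshold L n j < trunc L v := by
    have : (j : ℝ) * (2 * L / n) ≤ (q + 1) * (2 * L / n) :=
      mul_le_mul_of_nonneg_right (Nat.ceil_lt_add_one hq0).le hstep.le
    rw [threshold]; linarith
  have hj3 : j < n + 1 := by
    have h1 : (j : ℝ) * (2 * L / n) < n * (2 * L / n) := by
      have : (n : ℝ) * (2 * L / n) = 2 * L := by field_simp
      rw [this]
      rw [threshold] at hj2; linarith
    have := lt_of_mul_lt_mul_right h1 hstep.le
    have : j < n := by exact_mod_cast this
    omega
  have hj0 : -L ≤ threshold L n j := by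
    have : (0 : ℝ) ≤ j * (2 * L / n) := by positivity
    rw [threshold]; linarith
  have h1 : threshold L n j < v := by
    rw [trunc_eq hL.le, lt_max_iff] at hj2
    rcases hj2 with h | h
    · linarith
    · exact h.trans_le (min_le_right _ _)
  have h2 := h ⟨j, hj3⟩ h1
  have h3 : threshold L n j < trunc L v' := by
    rw [trunc_eq hL.le]
    exact lt_max_of_lt_right (lt_min (by linarith) h2)
  linarith

theorem abs_trunc_sub_trunc_le {L : ℝ} (hL : 0 < L) {n : ℕ} (hn : 0 < n) {v v' : ℝ}
    (h : ∀ j : Fin (n + 1), threshold L n j < v ↔ threshold L n j < v') :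
    |trunc L v - trunc L v'| ≤ 2 * L / n :=
  abs_sub_le_iff.2 ⟨trunc_sub_trunc_le hL hn fun j => (h j).1,
    trunc_sub_trunc_le hL hn fun j => (h j).2⟩

/-! ### Excess losses of truncated predictors and their cells -/

section Class

variable {X : Type*} {n N : ℕ}

/-- The truncated linear combination with coefficients `c i`, `i ∈ S`. -/
noncomputable def predictor (L : ℝ) (g : Fin N → X → ℝ) (S : Finset (Fin N)) (c : Fin N → ℝ)
    (x : X) : ℝ :=
  trunc L (∑ i ∈ S, c i * g i x)

/-- The excess loss of the predictor `u` over `fr`, for the response `Y`. -/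
def excess (fr : X → ℝ) (Y : X × ℝ → ℝ) (u : X → ℝ) (z : X × ℝ) : ℝ :=
  (u z.1 - Y z) ^ 2 - (fr z.1 - Y z) ^ 2

theorem excess_eq (fr : X → ℝ) (Y : X × ℝ → ℝ) (u : X → ℝ) (z : X × ℝ) :
    excess fr Y u z = (u z.1 - fr z.1) * (u z.1 + fr z.1 - 2 * Y z) := by
  rw [excess]; ring

theorem abs_excess_sub_le {L d : ℝ} {fr : X → ℝ} {Y : X × ℝ → ℝ} {u u' : X → ℝ} {z : X × ℝ}
    (hY : |Y z| ≤ L) (hu : |u z.1| ≤ L) (hu' : |u' z.1| ≤ L) (h : |u z.1 - u' z.1| ≤ d) :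
    |excess fr Y u z - excess fr Y u' z| ≤ d * (4 * L) := by
  have : excess fr Y u z - excess fr Y u' z
      = (u z.1 - u' z.1) * (u z.1 + u' z.1 - 2 * Y z) := by rw [excess, excess]; ring
  rw [this, abs_mul]
  refine mul_le_mul h ?_ (abs_nonneg _) ((abs_nonneg _).trans h)
  rw [abs_le] at *
  constructor <;> linarith

theorem abs_excess_le {L : ℝ} {fr : X → ℝ} {Y : X × ℝ → ℝ} {u : X → ℝ} {z : X × ℝ}
    (hY : |Y z| ≤ L) (hfr : |fr z.1| ≤ L) (hu : |u z.1| ≤ L) : |excess fr Y u z| ≤ 16 * L ^ 2 := by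
  rw [excess_eq, abs_mul]
  have h1 : |u z.1 - fr z.1| ≤ 4 * L := by
    rw [abs_le] at *; constructor <;> linarith
  have h2 : |u z.1 + fr z.1 - 2 * Y z| ≤ 4 * L := by
    rw [abs_le] at *; constructor <;> linarith
  calc _ ≤ (4 * L) * (4 * L) := mul_le_mul h1 h2 (abs_nonneg _) ((abs_nonneg _).trans h1)
    _ = 16 * L ^ 2 := by ring

theorem excess_sq_le {L : ℝ} {fr : X → ℝ} {Y : X × ℝ → ℝ} {u : X → ℝ} {z : X × ℝ}
    (hY : |Y z| ≤ L) (hfr : |fr z.1| ≤ L) (hu : |u z.1| ≤ L) :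
    excess fr Y u z ^ 2 ≤ 16 * L ^ 2 * (u z.1 - fr z.1) ^ 2 := by
  rw [excess_eq, mul_pow, mul_comm]
  refine mul_le_mul_of_nonneg_right ?_ (sq_nonneg _)
  have h2 : |u z.1 + fr z.1 - 2 * Y z| ≤ 4 * L := by
    rw [abs_le] at *; constructor <;> linarith
  rw [← sq_abs]
  calc _ ≤ (4 * L) ^ 2 := pow_le_pow_left₀ (abs_nonneg _) h2 2
    _ = _ := by ring

/-- The penalty weighs `S` by `n ^ (-(a + 4) |S|)`: the part `4` cancels the number of patterns, and
the rest sums over all `S` to `(1 + n ^ (-a)) ^ N ≤ exp (N n ^ (-a))`. -/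
theorem sum_pattern_exp_le {α : Type*} [Fintype α] {E : α → Fin N → ℝ} {t : α → ℝ} {a c₂ η κ : ℝ}
    (hn : 2 ≤ n) (hα : Fintype.card α + 1 ≤ n ^ 4) (hκ : 2 * η * κ = a + 4)
    (hN : (N : ℝ) ≤ c₂ * (n : ℝ) ^ a) :
    ∑ S : Finset (Fin N), ((patterns E t S).card : ℝ)
      * Real.exp (-(η * n * (2 * κ * (S.card * Real.log n / n)))) ≤ Real.exp c₂ := by
  have hn0 : (0 : ℝ) < n := by positivity
  set x : ℝ := (n : ℝ) ^ (-a) with hx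
  have hx0 : 0 < x := Real.rpow_pos_of_pos hn0 _
  have hterm : ∀ S : Finset (Fin N), ((patterns E t S).card : ℝ)
      * Real.exp (-(η * n * (2 * κ * (S.card * Real.log n / n)))) ≤ x ^ S.card := by
    intro S
    have h1 : -(η * n * (2 * κ * (S.card * Real.log n / n)))
        = S.card * (Real.log n * (-(a + 4))) := by
      rw [← hκ]; field_simp
    have h2 : ((patterns E t S).card : ℝ) ≤ ((n : ℝ) ^ 4) ^ S.card := by
      have := (card_patterns_le E t S).trans (Nat.pow_le_pow_left hα _)
      exact_mod_cast this
    rw [h1, Real.exp_nat_mul, ← Real.rpow_def_of_pos hn0]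
    refine (mul_le_mul_of_nonneg_right h2 (by positivity)).trans (le_of_eq ?_)
    have h4 : (n : ℝ) ^ 4 = (n : ℝ) ^ (4 : ℝ) := by norm_cast
    rw [← mul_pow, h4, ← Real.rpow_add hn0, hx]
    congr 2
    ring
  refine (Finset.sum_le_sum fun S _ => hterm S).trans ?_
  have h1 : ∑ S : Finset (Fin N), x ^ S.card = (x + 1) ^ N := by
    have := Fintype.sum_pow_mul_eq_add_pow (Fin N) x 1
    simpa using this
  rw [h1]
  have h2 : (N : ℝ) * x ≤ c₂ := by
    calc (N : ℝ) * x ≤ c₂ * (n : ℝ) ^ a * x := mul_le_mul_of_nonneg_right hN hx0.le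
      _ = c₂ := by rw [hx, mul_assoc, ← Real.rpow_add hn0]; simp
  calc (x + 1) ^ N ≤ Real.exp x ^ N :=
        pow_le_pow_left₀ (by positivity) (Real.add_one_le_exp x) N
    _ = Real.exp (N * x) := (Real.exp_nat_mul x N).symm
    _ ≤ Real.exp c₂ := Real.exp_le_exp.2 h2

variable {L : ℝ} {g : Fin N → X → ℝ}

/-- The points of a sample and a ghost sample. -/
def pairPoint (w : Fin n → (X × ℝ) × (X × ℝ)) (p : Fin n × Bool) : X :=
  if p.2 then (w p.1).1.1 else (w p.1).2.1

/-- A cell records the support and which thresholds are exceeded at the `2 n` points; this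
determines the truncated values up to `2 L / n`. -/
theorem exists_isCellMap {a c₂ η κ : ℝ} (hL : 0 < L) (hn : 2 ≤ n) (hκ : 2 * η * κ = a + 4)
    (hN : (N : ℝ) ≤ c₂ * (n : ℝ) ^ a) {fr : X → ℝ} {Y : X × ℝ → ℝ} (hY : ∀ z, |Y z| ≤ L)
    (w : Fin n → (X × ℝ) × (X × ℝ)) :
    ∃ (C : Finset (Finset (Fin N) × Finset ((Fin n × Bool) × Fin (n + 1))))
      (τ : Finset (Fin N) × (Fin N → ℚ) → Finset (Fin N) × Finset ((Fin n × Bool) × Fin (n + 1)))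
      (pc : Finset (Fin N) × Finset ((Fin n × Bool) × Fin (n + 1)) → ℝ),
      IsCellMap (fun i : Finset (Fin N) × (Fin N → ℚ) =>
          excess fr Y (predictor L g i.1 fun k => (i.2 k : ℝ)))
        (fun i => 2 * κ * (i.1.card * Real.log n / n)) (2 * L / n * (4 * L)) w C τ pc ∧
      ∑ c ∈ C, Real.exp (-(η * n * pc c)) ≤ Real.exp c₂ := by
  classical
  let E : (Fin n × Bool) × Fin (n + 1) → Fin N → ℝ := fun p i => g i (pairPoint w p.1)
  let t : (Fin n × Bool) × Fin (n + 1) → ℝ := fun p => threshold L n p.2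
  refine ⟨Finset.univ.filter fun c => c.2 ∈ patterns E t c.1,
    fun i => (i.1, pattern E t i.1 fun k => (i.2 k : ℝ)),
    fun c => 2 * κ * (c.1.card * Real.log n / n), ⟨fun i => ?_, fun i => le_rfl, ?_⟩, ?_⟩
  · simp only [Finset.mem_filter, Finset.mem_univ, true_and]
    exact pattern_mem_patterns _ _ _ _
  · rintro ⟨S, c⟩ ⟨S', c'⟩ hij
    simp only [Prod.mk.injEq] at hij
    obtain ⟨rfl, hp⟩ := hij
    have hclose : ∀ p : Fin n × Bool,
        |predictor L g S (fun k => (c k : ℝ)) (pairPoint w p)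
          - predictor L g S (fun k => (c' k : ℝ)) (pairPoint w p)| ≤ 2 * L / n := by
      intro p
      refine abs_trunc_sub_trunc_le hL (by omega) fun j => ?_
      have := Finset.ext_iff.1 hp (p, j)
      rwa [mem_pattern, mem_pattern] at this
    intro k
    exact ⟨abs_excess_sub_le (hY _) (abs_trunc_le hL.le _) (abs_trunc_le hL.le _)
        (hclose (k, true)),
      abs_excess_sub_le (hY _) (abs_trunc_le hL.le _) (abs_trunc_le hL.le _)
        (hclose (k, false))⟩
  · have hα : Fintype.card ((Fin n × Bool) × Fin (n + 1)) + 1 ≤ n ^ 4 := by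
      simp only [Fintype.card_prod, Fintype.card_fin, Fintype.card_bool]
      nlinarith [Nat.mul_le_mul hn hn, Nat.mul_le_mul (Nat.mul_le_mul hn hn) (le_refl (n * n))]
    refine le_trans (le_of_eq ?_) (sum_pattern_exp_le (E := E) (t := t) hn hα hκ hN)
    rw [Finset.sum_filter, Fintype.sum_prod_type]
    refine Finset.sum_congr rfl fun S _ => ?_
    rw [← Finset.sum_filter]
    dsimp only
    rw [Finset.sum_const, nsmul_eq_mul, Finset.filter_univ_mem]

end Class

theorem excess_eq_sq_add {X : Type*} (fr : X → ℝ) (Y : X × ℝ → ℝ) (u : X → ℝ) (z : X × ℝ) :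
    excess fr Y u z = (u z.1 - fr z.1) ^ 2 + 2 * ((u z.1 - fr z.1) * (fr z.1 - Y z)) := by
  rw [excess]; ring

/-! ### The regression function as conditional mean -/

section Regression

open ProbabilityTheory

variable {X : Type*} [MeasurableSpace X] {L : ℝ}

/-- The regression function, truncated. -/
noncomputable def clipReg (L : ℝ) (ρ : Measure (X × ℝ)) [IsFiniteMeasure ρ] (x : X) : ℝ :=
  trunc L (regressionFun ρ x)

/-- The response, truncated. -/
noncomputable def clipResp (L : ℝ) (z : X × ℝ) : ℝ := trunc L z.2

theorem measurable_regressionFun (ρ : Measure (X × ℝ)) [IsFiniteMeasure ρ] :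
    Measurable (regressionFun ρ) :=
  (StronglyMeasurable.integral_kernel (κ := ρ.condKernel)
    (f := fun y : ℝ => y) stronglyMeasurable_id).measurable

theorem measurable_clipReg (hL : 0 ≤ L) (ρ : Measure (X × ℝ)) [IsFiniteMeasure ρ] :
    Measurable (clipReg L ρ) :=
  (continuous_trunc hL).measurable.comp (measurable_regressionFun ρ)

theorem measurable_clipResp (hL : 0 ≤ L) : Measurable (clipResp L : X × ℝ → ℝ) :=
  (continuous_trunc hL).measurable.comp measurable_snd

variable {ρ : Measure (X × ℝ)} [IsProbabilityMeasure ρ]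

theorem ae_condKernel_abs_le (hy : ∀ᵐ z ∂ρ, |z.2| ≤ L) :
    ∀ᵐ x ∂ρ.fst, ∀ᵐ y ∂(ρ.condKernel x), |y| ≤ L := by
  rw [← ρ.disintegrate ρ.condKernel] at hy
  exact Measure.ae_ae_of_ae_compProd hy

theorem clipReg_ae_eq (hy : ∀ᵐ z ∂ρ, |z.2| ≤ L) : clipReg L ρ =ᵐ[ρ.fst] regressionFun ρ := by
  filter_upwards [ae_condKernel_abs_le hy] with x hx
  refine trunc_of_abs_le ?_
  have := norm_integral_le_of_norm_le_const (f := fun y : ℝ => y) hx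
  simpa [regressionFun] using this

/-- Given `x`, the response has conditional mean the regression function; the truncations alter
nothing almost surely, but provide bounds valid everywhere. -/
theorem integral_mul_sub_clipResp (hL : 0 ≤ L) (hy : ∀ᵐ z ∂ρ, |z.2| ≤ L) {u : X → ℝ}
    (hu : Integrable u ρ.fst) :
    Integrable (fun z : X × ℝ => u z.1 * (clipReg L ρ z.1 - clipResp L z)) ρ ∧
    ∫ z, u z.1 * (clipReg L ρ z.1 - clipResp L z) ∂ρ = 0 := by
  have hu' : Integrable (fun z : X × ℝ => u z.1) ρ := hu.comp_measurable measurable_fst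
  have hint : Integrable (fun z : X × ℝ => u z.1 * (clipReg L ρ z.1 - clipResp L z)) ρ := by
    refine hu'.mul_bdd (c := L + L) ?_ (Filter.Eventually.of_forall fun z => ?_)
    · exact (((measurable_clipReg hL ρ).comp measurable_fst).sub
        (measurable_clipResp hL)).aestronglyMeasurable
    · exact (norm_sub_le _ _).trans (add_le_add (abs_trunc_le hL _) (abs_trunc_le hL _))
  refine ⟨hint, ?_⟩
  rw [← Measure.integral_condKernel hint]
  refine integral_eq_zero_of_ae ?_
  filter_upwards [ae_condKernel_abs_le hy, clipReg_ae_eq hy] with x hx hx2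
  simp only [Pi.zero_apply]
  have h1 : (fun y : ℝ => clipResp L (x, y)) =ᵐ[ρ.condKernel x] fun y => y := by
    filter_upwards [hx] with y hy using trunc_of_abs_le hy
  have h2 : Integrable (fun y : ℝ => clipResp L (x, y)) (ρ.condKernel x) :=
    Integrable.of_bound ((measurable_clipResp hL).comp measurable_prodMk_left).aestronglyMeasurable
      L (Filter.Eventually.of_forall fun y => abs_trunc_le hL _)
  rw [integral_const_mul, integral_sub (integrable_const _) h2, integral_congr_ae h1, hx2]
  simp [regressionFun]

/-- The mean excess loss is the squared distance to the regression function. -/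
theorem integral_excess (hL : 0 ≤ L) (hy : ∀ᵐ z ∂ρ, |z.2| ≤ L) {u : X → ℝ}
    (hu : MemLp u 2 ρ.fst) :
    Integrable (excess (clipReg L ρ) (clipResp L) u) ρ ∧
    ∫ z, excess (clipReg L ρ) (clipResp L) u z ∂ρ = ∫ x, (u x - clipReg L ρ x) ^ 2 ∂ρ.fst := by
  have hfr : MemLp (clipReg L ρ) 2 ρ.fst :=
    MemLp.of_bound (measurable_clipReg hL ρ).aestronglyMeasurable L
      (Filter.Eventually.of_forall fun x => abs_trunc_le hL _)
  have hd := hu.sub hfr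
  obtain ⟨h1, h2⟩ := integral_mul_sub_clipResp hL hy (hd.integrable one_le_two)
  have h3 := hd.integrable_sq
  have h4 : Integrable (fun z : X × ℝ => (u z.1 - clipReg L ρ z.1) ^ 2) ρ :=
    h3.comp_measurable measurable_fst
  have h5 : excess (clipReg L ρ) (clipResp L) u = fun z => (u z.1 - clipReg L ρ z.1) ^ 2
      + 2 * ((u z.1 - clipReg L ρ z.1) * (clipReg L ρ z.1 - clipResp L z)) :=
    funext fun z => excess_eq_sq_add _ _ _ _
  simp only [Pi.sub_apply] at h1 h2
  refine ⟨h5 ▸ h4.add (h1.const_mul 2), ?_⟩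
  rw [h5, integral_add h4 (h1.const_mul 2), integral_const_mul, h2, mul_zero, add_zero]
  exact (integral_map (μ := ρ) (φ := Prod.fst) (f := fun x => (u x - clipReg L ρ x) ^ 2)
    measurable_fst.aemeasurable h3.aestronglyMeasurable).symm

theorem integral_sq_le_of_eLpNorm_le {μ : Measure X} {v : X → ℝ} {b : ℝ}
    (hv : AEStronglyMeasurable v μ) (hb : 0 ≤ b) (h : eLpNorm v 2 μ ≤ ENNReal.ofReal b) :
    MemLp v 2 μ ∧ ∫ x, v x ^ 2 ∂μ ≤ b ^ 2 := by
  have hmem : MemLp v 2 μ := ⟨hv, h.trans_lt ENNReal.ofReal_lt_top⟩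
  refine ⟨hmem, ?_⟩
  have h1 := hmem.eLpNorm_eq_integral_rpow_norm (by norm_num) (by norm_num)
  rw [h1] at h
  have h2 := (ENNReal.ofReal_le_ofReal_iff hb).1 h
  simp only [ENNReal.toReal_ofNat, Real.norm_eq_abs, Real.rpow_ofNat, sq_abs] at h2
  have h0 : 0 ≤ ∫ x, v x ^ 2 ∂μ := integral_nonneg fun x => sq_nonneg _
  calc ∫ x, v x ^ 2 ∂μ = ((∫ x, v x ^ 2 ∂μ) ^ ((2 : ℝ)⁻¹)) ^ 2 := by
        rw [← Real.rpow_natCast, ← Real.rpow_mul h0]; norm_num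
    _ ≤ b ^ 2 := pow_le_pow_left₀ (by positivity) h2 2

end Regression

/-! ### Uniform deviation bound for sparse predictors -/

section Deviation

variable {X : Type*} [MeasurableSpace X] {L : ℝ} {n N : ℕ}
variable {ρ : Measure (X × ℝ)} [IsProbabilityMeasure ρ] {g : Fin N → X → ℝ}

theorem measurable_predictor (hL : 0 ≤ L) (hg : ∀ i, Measurable (g i)) (S : Finset (Fin N))
    (c : Fin N → ℝ) : Measurable (predictor L g S c) :=
  (continuous_trunc hL).measurable.comp
    (Finset.measurable_fun_sum S fun i _ => (hg i).const_mul (c i))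

theorem measurable_excess {fr : X → ℝ} {Y : X × ℝ → ℝ} {u : X → ℝ} (hfr : Measurable fr)
    (hY : Measurable Y) (hu : Measurable u) : Measurable (excess fr Y u) := by
  unfold excess
  fun_prop

theorem memLp_predictor (hL : 0 ≤ L) (hg : ∀ i, Measurable (g i)) (S : Finset (Fin N))
    (c : Fin N → ℝ) : MemLp (predictor L g S c) 2 ρ.fst :=
  MemLp.of_bound (measurable_predictor hL hg S c).aestronglyMeasurable L
    (Filter.Eventually.of_forall fun _ => abs_trunc_le hL _)

/-- The excess risk of all truncated combinations of dictionary elements is controlled by their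
empirical excess risk and the number of elements they use. -/
theorem exists_integral_excess_le {a c₂ : ℝ} (hL : 0 < L) (ha : 0 ≤ a) (hn : 2 ≤ n)
    (hN : (N : ℝ) ≤ c₂ * (n : ℝ) ^ a) (hy : ∀ᵐ z ∂ρ, |z.2| ≤ L) (hg : ∀ i, Measurable (g i)) :
    ∃ G : (Fin n → X × ℝ) → ℝ, Integrable G (Measure.pi fun _ => ρ) ∧
      ∫ z, G z ∂(Measure.pi fun _ => ρ) ≤ (48 * L ^ 2 + 200 * L ^ 2 * Real.exp c₂) / n ∧
      ∀ z (S : Finset (Fin N)) (c : Fin N → ℝ),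
        ∫ u, excess (clipReg L ρ) (clipResp L) (predictor L g S c) u ∂ρ
          - 2 * (1 / (n : ℝ) * ∑ k,
              excess (clipReg L ρ) (clipResp L) (predictor L g S c) (z k))
          - 2 * ((a + 4) * (100 * L ^ 2)) * (S.card * Real.log n / n) ≤ G z := by
  have hn0 : 0 < n := by omega
  have hn0' : (0 : ℝ) < n := by positivity
  have hYb : ∀ z : X × ℝ, |clipResp L z| ≤ L := fun z => abs_trunc_le hL.le _
  have hfb : ∀ x, |clipReg L ρ x| ≤ L := fun x => abs_trunc_le hL.le _
  have hub : ∀ S c x, |predictor L g S c x| ≤ L := fun S c x => abs_trunc_le hL.le _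
  have hem : ∀ S c, Measurable (excess (clipReg L ρ) (clipResp L) (predictor L g S c)) :=
    fun S c => measurable_excess (measurable_clipReg hL.le ρ) (measurable_clipResp hL.le)
      (measurable_predictor hL.le hg S c)
  have heb : ∀ S c z, |excess (clipReg L ρ) (clipResp L) (predictor L g S c) z| ≤ 16 * L ^ 2 :=
    fun S c z => abs_excess_le (hYb z) (hfb _) (hub _ _ _)
  obtain ⟨G, hG1, hG2, hG3⟩ := exists_integral_sub_le ρ (ι := Finset (Fin N) × (Fin N → ℚ))
    (b := 16 * L ^ 2) (η := 2 / (25 * (16 * L ^ 2))) (δ := 2 * L / n * (4 * L))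
    (A := Real.exp c₂) (n := n)
    (l := fun i => excess (clipReg L ρ) (clipResp L) (predictor L g i.1 fun k => (i.2 k : ℝ)))
    (pen := fun i => 2 * ((a + 4) * (100 * L ^ 2)) * (i.1.card * Real.log n / n))
    (by positivity) hn0 (by positivity) rfl (fun i z => heb _ _ z) (fun i => hem _ _)
    (fun i => by
      obtain ⟨-, h2⟩ := integral_excess hL.le hy (memLp_predictor hL.le hg i.1 fun k => (i.2 k : ℝ))
      rw [h2, ← integral_const_mul]
      have hsub := ((memLp_predictor (ρ := ρ) hL.le hg i.1 fun k => (i.2 k : ℝ)).sub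
        (MemLp.of_bound (measurable_clipReg hL.le ρ).aestronglyMeasurable L
          (Filter.Eventually.of_forall fun x => hfb x))).integrable_sq
      simp only [Pi.sub_apply] at hsub
      have h3 := (integral_map (μ := ρ) (φ := Prod.fst)
        (f := fun x => 16 * L ^ 2 * (predictor L g i.1 (fun k => (i.2 k : ℝ)) x
          - clipReg L ρ x) ^ 2)
        measurable_fst.aemeasurable (hsub.const_mul _).aestronglyMeasurable)
      rw [Measure.fst, h3]
      refine integral_mono ?_ ((hsub.const_mul _).comp_measurable measurable_fst) fun z => ?_
      · refine integrable_comp_of_bound (b := (16 * L ^ 2) ^ 2) ((hem _ _).pow_const 2) fun u => ?_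
        rw [abs_pow]; exact pow_le_pow_left₀ (abs_nonneg _) (heb _ _ u) 2
      · exact excess_sq_le (hYb z) (hfb _) (hub _ _ _))
    (fun i => by
      have := Real.log_natCast_nonneg n
      positivity)
    (fun w => exists_isCellMap hL hn (by field_simp; ring) hN hYb w)
  refine ⟨G, hG1, hG2.trans (le_of_eq (by field_simp; ring)), fun z S => ?_⟩
  -- Rational coefficients kept the index set countable, hence the supremum measurable; continuity
  -- in `c` extends the bound to real ones.
  have hpt : ∀ u : X × ℝ, Continuous fun c : Fin N → ℝ =>
      excess (clipReg L ρ) (clipResp L) (predictor L g S c) u := by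
    intro u
    have : Continuous fun c : Fin N → ℝ => predictor L g S c u.1 :=
      (continuous_trunc hL.le).comp (by fun_prop)
    unfold excess
    fun_prop
  have hcont : Continuous fun c : Fin N → ℝ =>
      ∫ u, excess (clipReg L ρ) (clipResp L) (predictor L g S c) u ∂ρ :=
    continuous_of_dominated (bound := fun _ => 16 * L ^ 2)
      (fun c => (hem S c).aestronglyMeasurable)
      (fun c => Filter.Eventually.of_forall fun u => heb S c u) (integrable_const _)
      (Filter.Eventually.of_forall hpt)
  have hdense : DenseRange (Pi.map fun (_ : Fin N) (q : ℚ) => (q : ℝ)) :=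
    DenseRange.piMap fun _ => Rat.denseRange_cast
  intro c
  refine hdense.induction_on c ?_ fun q => hG3 z (S, q)
  refine isClosed_le ?_ continuous_const
  exact (hcont.sub (continuous_const.mul (continuous_const.mul
    (continuous_finsetSum _ fun k _ => hpt _)))).sub continuous_const

end Deviation

/-! ### The penalized empirical risk of the estimator -/

section Estimator

variable {X : Type*} {n N : ℕ}

theorem exists_eq_sum_of_mem_span_atom {x : Fin n → X} {g : Fin N → X → ℝ} {S : Finset (Fin N)}
    {I : Set (Fin N)} (hI : ∀ i ∈ I, i ∈ S) {f : X → ℝ}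
    (hf : f ∈ Submodule.span ℝ (atom x g '' I)) :
    ∃ c : Fin N → ℝ, ∀ u, f u = ∑ i ∈ S, c i * g i u := by
  induction hf using Submodule.span_induction with
  | mem f hf =>
    obtain ⟨i, hi, rfl⟩ := hf
    refine ⟨Pi.single i (empNorm fun k => g i (x k))⁻¹, fun u => ?_⟩
    rw [Finset.sum_eq_single i (fun j _ hj => by rw [Pi.single_eq_of_ne hj, zero_mul])
      (fun h => absurd (hI i hi) h), Pi.single_eq_same]
    rfl
  | zero => exact ⟨0, fun u => by simp⟩
  | add f₁ f₂ _ _ h₁ h₂ =>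
    obtain ⟨c₁, h₁⟩ := h₁
    obtain ⟨c₂, h₂⟩ := h₂
    exact ⟨c₁ + c₂, fun u => by simp [h₁, h₂, add_mul, Finset.sum_add_distrib]⟩
  | smul r f _ h =>
    obtain ⟨c, h⟩ := h
    exact ⟨r • c, fun u => by simp [h, Finset.mul_sum, mul_assoc]⟩

theorem IsRun.exists_predictor {x : Fin n → X} {y : Fin n → ℝ} {g : Fin N → X → ℝ} {s : ℕ}
    {T : ℕ → Finset (Fin N)} {f : ℕ → X → ℝ} (hrun : IsRun x y g s T f) (L : ℝ) {m : ℕ}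
    (hm : 0 < m) : ∃ (S : Finset (Fin N)) (c : Fin N → ℝ), S.card ≤ m * s ∧
      (fun u => trunc L (f m u)) = predictor L g S c := by
  classical
  obtain ⟨k, rfl⟩ : ∃ k, m = k + 1 := ⟨m - 1, by omega⟩
  obtain ⟨c, hc⟩ := exists_eq_sum_of_mem_span_atom (S := (Finset.range (k + 1)).biUnion T)
    (by
      rintro i ⟨l, hl, hi⟩
      exact Finset.mem_biUnion.2 ⟨l, Finset.mem_range.2 (by omega), hi⟩) (hrun.mem_span k)
  refine ⟨_, c, ?_, funext fun u => by rw [hc, predictor]⟩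
  have := Finset.card_biUnion_le_card_mul (Finset.range (k + 1)) T s fun l _ => by
    rw [(hrun.select l).2.1]; exact min_le_left _ _
  simpa using this

/-- The empirical risk bound for the algorithm with `m + 1` iterations: the excess of the comparison
function `h`, the approximation error of the algorithm and the penalty. -/
noncomputable def oracleBound (L κ : ℝ) (s m : ℕ) (fr : X → ℝ) (g : Fin N → X → ℝ) (c : Fin N → ℝ)
    (z : Fin n → X × ℝ) : ℝ :=
  1 / (n : ℝ) * ∑ k, excess fr (clipResp L) (∑ i, c i • g i) (z k)
    + 1944 * ((∑ i, |c i|) * ∑ i, |c i| * (1 / (n : ℝ) * ∑ k, g i (z k).1 ^ 2)) / s / m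
    + κ * ((m + 1 : ℕ) * s * Real.log n / n)

/-- On a sample with bounded responses and small coherence, the penalized empirical excess risk of
the estimator is at most the oracle bound. -/
theorem IsEstimator.exists_excess_le {z : Fin n → X × ℝ} {g : Fin N → X → ℝ} {L κ : ℝ} {s : ℕ}
    {fhat : X → ℝ} (hest : IsEstimator z g L κ s fhat) (hκ : 0 ≤ κ) (hs : 1 ≤ s)
    (hy : ∀ k, |(z k).2| ≤ L)
    (hM : 2 * coherence (fun i => (z i).1) g * ((s : ℝ) - 1) ≤ 1) (fr : X → ℝ)
    (c : Fin N → ℝ) {m : ℕ} (hm : 1 ≤ m) :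
    ∃ (S : Finset (Fin N)) (d : Fin N → ℝ), fhat = predictor L g S d ∧
      1 / (n : ℝ) * ∑ k, excess fr (clipResp L) fhat (z k) + κ * (S.card * Real.log n / n)
        ≤ oracleBound L κ s m fr g c z := by
  obtain ⟨T, f, mstar, hrun, hm0, hmin, hfhat⟩ := hest
  obtain ⟨S, d, hS, hSd⟩ := hrun.exists_predictor L hm0
  refine ⟨S, d, hfhat.trans hSd, ?_⟩
  have hY : ∀ k, clipResp L (z k) = (z k).2 := fun k => trunc_of_abs_le (hy k)
  have hlog := Real.log_natCast_nonneg n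
  have hrisk : ∀ q, penalizedRisk (fun i => (z i).1) (fun i => (z i).2) L κ s f q
      = 1 / (n : ℝ) * ∑ k, (trunc L (f q (z k).1) - (z k).2) ^ 2
        + κ * (q * s * Real.log n / n) := by
    intro q
    rw [penalizedRisk, empNorm_sq, empInner]
    congr 2
    exact Finset.sum_congr rfl fun k _ => by ring
  have h1 := hmin (m + 1) (by omega)
  rw [hrisk, hrisk] at h1
  have hcard : κ * (S.card * Real.log n / n) ≤ κ * (mstar * s * Real.log n / n) := by
    have : (S.card : ℝ) ≤ mstar * s := by exact_mod_cast hS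
    gcongr
  have h2 : 1 / (n : ℝ) * ∑ k, (trunc L (f (m + 1) (z k).1) - (z k).2) ^ 2
      ≤ empInner (fun i => (z i).2 - f (m + 1) (z i).1) (fun i => (z i).2 - f (m + 1) (z i).1) := by
    rw [empInner]
    refine mul_le_mul_of_nonneg_left (Finset.sum_le_sum fun k _ => ?_) (by positivity)
    have h3 := pow_le_pow_left₀ (abs_nonneg _) (abs_sub_trunc_le (hy k) (f (m + 1) (z k).1)) 2
    rw [sq_abs, sq_abs] at h3
    linarith
  have h3 := hrun.empInner_le hs hM c hm
  have h4 : ∀ u : X → ℝ, 1 / (n : ℝ) * ∑ k, excess fr (clipResp L) u (z k)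
      = 1 / (n : ℝ) * ∑ k, (u (z k).1 - (z k).2) ^ 2
        - 1 / (n : ℝ) * ∑ k, (fr (z k).1 - (z k).2) ^ 2 := by
    intro u
    simp only [excess, hY, Finset.sum_sub_distrib, mul_sub]
  have h5 : empInner (fun k => (z k).2 - (∑ i, c i • g i) (z k).1)
      (fun k => (z k).2 - (∑ i, c i • g i) (z k).1)
      = 1 / (n : ℝ) * ∑ k, ((∑ i, c i • g i) (z k).1 - (z k).2) ^ 2 := by
    rw [empInner]
    congr 1
    exact Finset.sum_congr rfl fun k _ => by ring
  have h6 : ∀ i, empInner (fun k => g i (z k).1) (fun k => g i (z k).1)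
      = 1 / (n : ℝ) * ∑ k, g i (z k).1 ^ 2 := by
    intro i
    rw [empInner]
    congr 1
    exact Finset.sum_congr rfl fun k _ => by ring
  rw [h5] at h3
  simp only [h6] at h3
  rw [oracleBound, h4, h4, hfhat]
  linarith

end Estimator

/-! ### Expectation and the oracle inequality -/

section Oracle

variable {X : Type*} [MeasurableSpace X] {L : ℝ} {n N : ℕ}
variable {ρ : Measure (X × ℝ)} [IsProbabilityMeasure ρ] {g : Fin N → X → ℝ}

theorem integral_oracleBound_le (hL : 0 ≤ L) (hn : 0 < n) (hy : ∀ᵐ z ∂ρ, |z.2| ≤ L)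
    (hg : ∀ i, Measurable (g i)) (hg1 : ∀ i, eLpNorm (g i) 2 ρ.fst = 1) (c : Fin N → ℝ)
    {A ε : ℝ} (hA : ∑ i, |c i| ≤ A) (hε : 0 ≤ ε)
    (hc : eLpNorm (regressionFun ρ - ∑ i, c i • g i) 2 ρ.fst ≤ ENNReal.ofReal ε)
    (κ : ℝ) (s m : ℕ) :
    Integrable (oracleBound L κ s m (clipReg L ρ) g c) (Measure.pi fun _ : Fin n => ρ) ∧
    ∫ z, oracleBound L κ s m (clipReg L ρ) g c z ∂(Measure.pi fun _ : Fin n => ρ)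
      ≤ ε ^ 2 + 1944 * A ^ 2 / s / m + κ * ((m + 1 : ℕ) * s * Real.log n / n) := by
  have hg2 : ∀ i, MemLp (g i) 2 ρ.fst ∧ ∫ x, g i x ^ 2 ∂ρ.fst ≤ 1 ^ 2 := fun i =>
    integral_sq_le_of_eLpNorm_le (hg i).aestronglyMeasurable zero_le_one (by simp [hg1])
  have hh : MemLp (∑ i, c i • g i) 2 ρ.fst :=
    memLp_finsetSum' _ fun i _ => (hg2 i).1.const_smul (c i)
  obtain ⟨he1, he2⟩ := integral_excess hL hy hh
  obtain ⟨hE1, hE2⟩ := integral_empirical (n := n) ρ hn he1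
  have hd := integral_sq_le_of_eLpNorm_le (v := regressionFun ρ - ∑ i, c i • g i)
    ((measurable_regressionFun ρ).aestronglyMeasurable.sub hh.1) hε hc
  have he3 : ∫ z, excess (clipReg L ρ) (clipResp L) (∑ i, c i • g i) z ∂ρ ≤ ε ^ 2 := by
    rw [he2]
    refine le_trans (le_of_eq (integral_congr_ae ?_)) hd.2
    filter_upwards [clipReg_ae_eq hy] with x hx
    rw [hx, Pi.sub_apply]
    ring
  have hgi : ∀ i, Integrable (fun z : X × ℝ => g i z.1 ^ 2) ρ := fun i =>
    (hg2 i).1.integrable_sq.comp_measurable measurable_fst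
  have hgi2 : ∀ i, ∫ z, g i z.1 ^ 2 ∂ρ ≤ 1 := fun i => by
    have := (integral_map (μ := ρ) (φ := Prod.fst) (f := fun x => g i x ^ 2)
      measurable_fst.aemeasurable (hg2 i).1.integrable_sq.aestronglyMeasurable)
    rw [← this]
    exact (hg2 i).2.trans_eq (one_pow 2)
  have hP := fun i => integral_empirical (n := n) ρ hn (hgi i)
  have hS1 : Integrable (fun z : Fin n → X × ℝ =>
      ∑ i, |c i| * (1 / (n : ℝ) * ∑ k, g i (z k).1 ^ 2)) (Measure.pi fun _ => ρ) :=
    integrable_finsetSum _ fun i _ => (hP i).1.const_mul _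
  have hS2 : ∫ z : Fin n → X × ℝ, ∑ i, |c i| * (1 / (n : ℝ) * ∑ k, g i (z k).1 ^ 2)
      ∂(Measure.pi fun _ => ρ) ≤ ∑ i, |c i| := by
    rw [integral_finsetSum _ fun i _ => (hP i).1.const_mul _]
    refine Finset.sum_le_sum fun i _ => ?_
    rw [integral_const_mul, (hP i).2]
    exact mul_le_of_le_one_right (abs_nonneg _) (hgi2 i)
  have hS3 := (((hS1.const_mul (∑ i, |c i|)).const_mul 1944).div_const (s : ℝ)).div_const (m : ℝ)
  unfold oracleBound
  refine ⟨(hE1.add hS3).add (integrable_const _), ?_⟩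
  erw [integral_add (hE1.add hS3) (integrable_const _), integral_add hE1 hS3]
  rw [hE2, integral_div,
    integral_div, integral_const_mul, integral_const_mul, integral_const, probReal_univ, one_smul]
  have h0 : 0 ≤ ∑ i, |c i| := Finset.sum_nonneg fun _ _ => abs_nonneg _
  have h1 : (∑ i, |c i|) * ∫ z : Fin n → X × ℝ,
      ∑ i, |c i| * (1 / (n : ℝ) * ∑ k, g i (z k).1 ^ 2) ∂(Measure.pi fun _ => ρ) ≤ A ^ 2 := by
    rw [sq]
    exact (mul_le_mul_of_nonneg_left hS2 h0).trans (mul_self_le_mul_self h0 hA)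
  gcongr

/-- The oracle inequality for the estimator. -/
theorem lintegral_estimator_le {a c₂ : ℝ} (hL : 0 < L) (ha : 0 ≤ a) (hn : 2 ≤ n)
    (hN : (N : ℝ) ≤ c₂ * (n : ℝ) ^ a) (hy : ∀ᵐ z ∂ρ, |z.2| ≤ L) (hg : ∀ i, Measurable (g i))
    (hg1 : ∀ i, eLpNorm (g i) 2 ρ.fst = 1) {s : ℕ} (hs : 1 ≤ s)
    (hM : ∀ᵐ z ∂(Measure.pi fun _ : Fin n => ρ),
      2 * coherence (fun i => (z i).1) g * ((s : ℝ) - 1) ≤ 1)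
    {fhat : (Fin n → X × ℝ) → X → ℝ}
    (hest : ∀ z, IsEstimator z g L ((a + 4) * (100 * L ^ 2)) s (fhat z)) (c : Fin N → ℝ)
    {A ε : ℝ} (hA : ∑ i, |c i| ≤ A) (hε : 0 ≤ ε)
    (hc : eLpNorm (regressionFun ρ - ∑ i, c i • g i) 2 ρ.fst ≤ ENNReal.ofReal ε) {m : ℕ}
    (hm : 1 ≤ m) :
    ∫⁻ z, (∫⁻ x, ENNReal.ofReal ((fhat z x - regressionFun ρ x) ^ 2) ∂ρ.fst)
        ∂(Measure.pi fun _ : Fin n => ρ) ≤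
      ENNReal.ofReal ((48 * L ^ 2 + 200 * L ^ 2 * Real.exp c₂) / n
        + 2 * (ε ^ 2 + 1944 * A ^ 2 / s / m
          + (a + 4) * (100 * L ^ 2) * ((m + 1 : ℕ) * s * Real.log n / n))) := by
  set κ := (a + 4) * (100 * L ^ 2) with hκ
  have hκ0 : 0 ≤ κ := by positivity
  obtain ⟨G, hG1, hG2, hG3⟩ := exists_integral_excess_le (ρ := ρ) hL ha hn hN hy hg
  obtain ⟨hR1, hR2⟩ := integral_oracleBound_le hL.le (by omega : 0 < n) hy hg hg1 c hA hε hc κ s m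
  set R := oracleBound (n := n) L κ s m (clipReg L ρ) g c
  have hys : ∀ᵐ z ∂(Measure.pi fun _ : Fin n => ρ), ∀ k, |(z k).2| ≤ L := by
    rw [ae_all_iff]
    exact fun k => (measurePreserving_eval (fun _ : Fin n => ρ) k).quasiMeasurePreserving.ae hy
  have hpt : ∀ᵐ z ∂(Measure.pi fun _ : Fin n => ρ),
      0 ≤ G z + 2 * R z ∧
      ∫⁻ x, ENNReal.ofReal ((fhat z x - regressionFun ρ x) ^ 2) ∂ρ.fst
        ≤ ENNReal.ofReal (G z + 2 * R z) := by
    filter_upwards [hys, hM] with z hz hMz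
    obtain ⟨S, d, hfd, hle⟩ := (hest z).exists_excess_le hκ0 hs hz hMz (clipReg L ρ) c hm
    have h1 := hG3 z S d
    have hmem : MemLp (predictor L g S d) 2 ρ.fst := memLp_predictor hL.le hg S d
    obtain ⟨-, h2⟩ := integral_excess hL.le hy hmem
    rw [hfd] at hle ⊢
    -- The deviation bound carries the penalty `2 κ |S| log n / n`, which is twice the one in the
    -- empirical bound and cancels.
    have h3 : ∫ x, (predictor L g S d x - clipReg L ρ x) ^ 2 ∂ρ.fst ≤ G z + 2 * R z := by
      rw [← h2]
      linarith
    have h4 : 0 ≤ ∫ x, (predictor L g S d x - clipReg L ρ x) ^ 2 ∂ρ.fst :=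
      integral_nonneg fun x => sq_nonneg _
    refine ⟨h4.trans h3, ?_⟩
    have hint := (hmem.sub (MemLp.of_bound (measurable_clipReg hL.le ρ).aestronglyMeasurable L
      (Filter.Eventually.of_forall fun x => abs_trunc_le hL.le _))).integrable_sq
    simp only [Pi.sub_apply] at hint
    have h5 : ∫⁻ x, ENNReal.ofReal ((predictor L g S d x - regressionFun ρ x) ^ 2) ∂ρ.fst
        = ENNReal.ofReal (∫ x, (predictor L g S d x - clipReg L ρ x) ^ 2 ∂ρ.fst) := by
      rw [ofReal_integral_eq_lintegral_ofReal hint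
        (Filter.Eventually.of_forall fun x => sq_nonneg _)]
      refine lintegral_congr_ae ?_
      filter_upwards [clipReg_ae_eq hy] with x hx
      rw [hx]
    rw [h5]
    exact ENNReal.ofReal_le_ofReal h3
  have hGR : Integrable (fun z => G z + 2 * R z) (Measure.pi fun _ : Fin n => ρ) :=
    hG1.add (hR1.const_mul 2)
  refine (lintegral_mono_ae (hpt.mono fun z hz => hz.2)).trans ?_
  rw [← ofReal_integral_eq_lintegral_ofReal hGR (hpt.mono fun z hz => hz.1)]
  refine ENNReal.ofReal_le_ofReal ?_
  rw [integral_add hG1 (hR1.const_mul 2), integral_const_mul]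
  linarith

end Oracle

/-! ### Approximation in the smoothness class -/

/-- Functions in the smoothness class are approximated by combinations with small coefficients. -/
theorem MemL1r.exists_sum {X : Type*} [MeasurableSpace X] {μ : Measure X}
    {g : (N : ℕ) → Fin N → X → ℝ} {r B : ℝ} {f : X → ℝ} (hf : MemL1r μ g r f)
    (hB : l1rNorm μ g r f < B) {N : ℕ} (hN : 1 ≤ N) :
    ∃ c : Fin N → ℝ, ∑ i, |c i| ≤ B ∧
      eLpNorm (f - ∑ i, c i • g N i) 2 μ ≤ ENNReal.ofReal (B * (N : ℝ) ^ (-r)) := by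
  obtain ⟨b, hb, hbB⟩ := exists_lt_of_csInf_lt hf hB
  obtain ⟨h, hspan, hl1, hlp⟩ := hb N hN
  have hne : {t : ℝ | ∃ c : Fin N → ℝ, h = ∑ i, c i • g N i ∧ t = ∑ i, |c i|}.Nonempty := by
    obtain ⟨c, hc⟩ := (Submodule.mem_span_range_iff_exists_fun ℝ).1 hspan
    exact ⟨_, c, hc.symm, rfl⟩
  obtain ⟨t, ⟨c, hc, rfl⟩, ht⟩ := exists_lt_of_csInf_lt hne (hl1.trans_lt hbB)
  refine ⟨c, ht.le, ?_⟩
  rw [← hc]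
  refine hlp.trans (ENNReal.ofReal_le_ofReal ?_)
  gcongr

/-- The exponent `2 r` is first lowered to `1 / (2 a)`, which keeps the constant free of `r`. -/
theorem rpow_neg_sq_le {a r c₁ : ℝ} {n N : ℕ} (ha : 0 < a) (hr : 0 < r) (har : 1 / (4 * r) ≤ a)
    (hc₁ : 0 < c₁) (hn : 0 < n) (hN : c₁ * (n : ℝ) ^ a ≤ N) :
    ((N : ℝ) ^ (-r)) ^ 2 ≤ c₁ ^ (-(1 / (2 * a))) * (n : ℝ) ^ (-(1 / 2) : ℝ) := by
  have hn0 : (0 : ℝ) < n := by positivity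
  have hpos : 0 < c₁ * (n : ℝ) ^ a := by positivity
  have hN0 : (0 : ℝ) < N := hpos.trans_le hN
  have hN1 : (1 : ℝ) ≤ N := by
    have : 0 < N := by exact_mod_cast hN0
    exact_mod_cast this
  have h1 : 1 / (2 * a) ≤ r * 2 := by
    rw [div_le_iff₀ (by positivity)] at har ⊢
    linarith
  calc ((N : ℝ) ^ (-r)) ^ 2 = (N : ℝ) ^ (-(r * 2)) := by
        rw [← Real.rpow_natCast, ← Real.rpow_mul hN0.le]; norm_num
    _ ≤ (N : ℝ) ^ (-(1 / (2 * a))) := Real.rpow_le_rpow_of_exponent_le hN1 (by linarith)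
    _ ≤ (c₁ * (n : ℝ) ^ a) ^ (-(1 / (2 * a))) :=
        Real.rpow_le_rpow_of_nonpos hpos hN (by
          have : 0 < 1 / (2 * a) := by positivity
          linarith)
    _ = c₁ ^ (-(1 / (2 * a))) * (n : ℝ) ^ (-(1 / 2) : ℝ) := by
        rw [Real.mul_rpow hc₁.le (by positivity), ← Real.rpow_mul hn0.le]
        congr 2
        field_simp

end OSGA

/-! ### Choice of constants and of the number of iterations -/

theorem corollary2 (L a : ℝ) (hL : 0 < L) (ha : 1 ≤ a) :
    ∃ κ : ℝ, 0 < κ ∧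
      ∀ B c₁ c₂ K : ℝ, 0 < c₁ →
        ∃ C : ℝ, 0 < C ∧
          ∀ (X : Type*) [MeasurableSpace X] (ρ : Measure (X × ℝ)) [IsProbabilityMeasure ρ],
            (∀ᵐ z ∂ρ, |z.2| ≤ L) →
          ∀ g : (N : ℕ) → Fin N → X → ℝ,
            (∀ N i, Measurable (g N i)) →
            (∀ N i, eLpNorm (g N i) 2 ρ.fst = 1) →
          ∀ r : ℝ, 0 < r → 1 / (4 * r) ≤ a →
            OSGA.MemL1r ρ.fst g r (OSGA.regressionFun ρ) →
            OSGA.l1rNorm ρ.fst g r (OSGA.regressionFun ρ) ≤ B →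
          ∀ n N s : ℕ, 2 ≤ n →
            c₁ * (n : ℝ) ^ a ≤ N → (N : ℝ) ≤ c₂ * (n : ℝ) ^ a →
            1 ≤ s → (s : ℝ) ≤ K * Real.sqrt (n / Real.log n) →
            (∀ᵐ z ∂(Measure.pi fun _ : Fin n => ρ),
              2 * OSGA.coherence (fun i => (z i).1) (g N) * ((s : ℝ) - 1) ≤ 1) →
          ∀ fhat : (Fin n → X × ℝ) → X → ℝ,
            (∀ z, OSGA.IsEstimator z (g N) L κ s (fhat z)) →
            ∫⁻ z, (∫⁻ x, ENNReal.ofReal ((fhat z x - OSGA.regressionFun ρ x) ^ 2) ∂ρ.fst)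
                ∂(Measure.pi fun _ : Fin n => ρ) ≤
              ENNReal.ofReal (C * ((n : ℝ) / Real.log n) ^ (-(1 / 2) : ℝ)) := by
  have ha0 : 0 < a := by linarith
  -- The solution of `2 η κ = a + 4` for `η = 2 / (25 b)` and `b = 16 L ^ 2`.
  refine ⟨(a + 4) * (100 * L ^ 2), by positivity, fun B c₁ c₂ K hc₁ => ?_⟩
  set κ := (a + 4) * (100 * L ^ 2) with hκ
  have hκ0 : 0 < κ := by positivity
  -- Strictly above `B`, since the infima defining the norms need not be attained.
  set A := |B| + 1 with hA
  have hA0 : 0 < A := by positivity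
  refine ⟨48 * L ^ 2 + 200 * L ^ 2 * Real.exp c₂ + 2 * (A ^ 2 * (2 * c₁ ^ (-(1 / (2 * a))))
    + 1944 * A ^ 2 + κ * (1 + 2 * |K|)), by positivity, ?_⟩
  intro X _ ρ _ hy g hg hg1 r hr har hmem hB n N s hn hN1 hN2 hs hsK hM fhat hest
  have hn0 : (0 : ℝ) < n := by positivity
  have hn2 : (2 : ℝ) ≤ n := by exact_mod_cast hn
  have hNpos : 1 ≤ N := by
    have : (0 : ℝ) < N := lt_of_lt_of_le (by positivity) hN1
    exact_mod_cast this
  obtain ⟨c, hcA, hc⟩ := hmem.exists_sum (B := A)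
    (hB.trans_lt ((le_abs_self B).trans_lt (lt_add_one _))) hNpos
  have hlog : 1 / 2 ≤ Real.log n := by
    have h1 := Real.log_le_log (by norm_num) hn2
    have h2 := Real.log_two_gt_d9
    linarith
  have hlog0 : 0 < Real.log n := by linarith
  set t := Real.sqrt (n / Real.log n) with ht
  have ht0 : 0 < t := Real.sqrt_pos.2 (by positivity)
  have ht2 : t ^ 2 = n / Real.log n := Real.sq_sqrt (by positivity)
  have hrate : ((n : ℝ) / Real.log n) ^ (-(1 / 2) : ℝ) = 1 / t := by
    rw [Real.rpow_neg (by positivity), ← Real.sqrt_eq_rpow, one_div]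
  have hs0 : (0 : ℝ) < s := by positivity
  -- About `t` atoms in total. Rounding up and the extra iteration cost at most `2 s ≤ 2 |K| t`
  -- more.
  set m := ⌈t / s⌉₊ with hm
  have hm1 : 1 ≤ m := Nat.ceil_pos.2 (by positivity)
  have hm0 : (0 : ℝ) < m := by positivity
  have hmt : t ≤ s * m := by
    have := Nat.le_ceil (t / s)
    rw [div_le_iff₀ hs0] at this
    linarith
  have hmt2 : ((m + 1 : ℕ) : ℝ) * s ≤ (1 + 2 * |K|) * t := by
    have h1 : (m : ℝ) ≤ t / s + 1 := (Nat.ceil_lt_add_one (by positivity)).le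
    have h2 : (s : ℝ) ≤ |K| * t := hsK.trans (mul_le_mul_of_nonneg_right (le_abs_self K) ht0.le)
    have h3 : ((m + 1 : ℕ) : ℝ) * s ≤ (t / s + 2) * s := by
      push_cast
      exact mul_le_mul_of_nonneg_right (by linarith) hs0.le
    have h4 : (t / s + 2) * s = t + 2 * s := by field_simp
    linarith
  refine (OSGA.lintegral_estimator_le hL ha0.le hn hN2 hy (hg N) (hg1 N) hs hM hest c hcA
    (by positivity) hc hm1).trans (ENNReal.ofReal_le_ofReal ?_)
  rw [hrate, ← hκ]
  have e1 : (48 * L ^ 2 + 200 * L ^ 2 * Real.exp c₂) / n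
      ≤ (48 * L ^ 2 + 200 * L ^ 2 * Real.exp c₂) * (1 / t) := by
    rw [div_eq_mul_one_div]
    have : t ≤ n := by
      refine Real.sqrt_le_iff.2 ⟨hn0.le, ?_⟩
      rw [div_le_iff₀ hlog0]
      nlinarith
    gcongr
  have e2 : (A * (N : ℝ) ^ (-r)) ^ 2 ≤ A ^ 2 * (2 * c₁ ^ (-(1 / (2 * a)))) * (1 / t) := by
    have h1 := OSGA.rpow_neg_sq_le ha0 hr har hc₁ (by omega : 0 < n) hN1
    have h2 : (n : ℝ) ^ (-(1 / 2) : ℝ) ≤ 2 * (1 / t) := by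
      rw [Real.rpow_neg hn0.le, ← Real.sqrt_eq_rpow, inv_le_comm₀ (by positivity) (by positivity)]
      have h3 : t / 2 ≤ Real.sqrt n := by
        refine Real.le_sqrt_of_sq_le ?_
        rw [div_pow, ht2, div_div, div_le_iff₀ (by positivity)]
        nlinarith
      calc (2 * (1 / t))⁻¹ = t / 2 := by field_simp
        _ ≤ _ := h3
    have h3 : (0 : ℝ) < c₁ ^ (-(1 / (2 * a))) := by positivity
    calc (A * (N : ℝ) ^ (-r)) ^ 2 = A ^ 2 * ((N : ℝ) ^ (-r)) ^ 2 := by ring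
      _ ≤ A ^ 2 * (c₁ ^ (-(1 / (2 * a))) * (2 * (1 / t))) := by
          refine mul_le_mul_of_nonneg_left (h1.trans ?_) (by positivity)
          exact mul_le_mul_of_nonneg_left h2 h3.le
      _ = _ := by ring
  have e3 : 1944 * A ^ 2 / s / m ≤ 1944 * A ^ 2 * (1 / t) := by
    rw [div_div, div_eq_mul_one_div]
    gcongr
  have e4 : κ * ((m + 1 : ℕ) * s * Real.log n / n) ≤ κ * (1 + 2 * |K|) * (1 / t) := by
    rw [mul_assoc κ]
    refine mul_le_mul_of_nonneg_left ?_ hκ0.le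
    have h1 : Real.log n / n = 1 / t ^ 2 := by rw [ht2, one_div_div]
    rw [mul_div_assoc, h1]
    calc ((m + 1 : ℕ) : ℝ) * s * (1 / t ^ 2) ≤ (1 + 2 * |K|) * t * (1 / t ^ 2) := by gcongr
      _ = (1 + 2 * |K|) * (1 / t) := by field_simp
  linarith
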